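/- All graphs are finite and simple (no loops, no multiple edges). For a graph $X$ with $m$ edges, let $e_1,\dots,e_{2m}$ be its oriented edges (each edge of $X$ taken with both of its orientations), and write $s(e)$ and $t(e)$ for the starting and terminal vertex of an oriented edge $e$. Let $M=M(X)$ be the $2m\times 2m$ matrix with $M_{ij}=1$ if $t(e_i)=s(e_j)$ and $s(e_i)\neq t(e_j)$, and $M_{ij}=0$ otherwise. Then $M+M^T$ is a symmetric $0/1$ matrix with zero diagonal; the symmetric edge graph $\gamma(X)$ is the graph whose adjacency matrix is $M+M^T$. Theorem. Let $X$ and $Y$ be connected graphs. Then $\gamma(X)$ is isomorphic to $\gamma(Y)$ if and only if $X$ is isomorphic to $Y$. -/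

import Mathlib

namespace SimpleGraph

/-- The edge adjacency matrix `M` of a graph `X`, indexed by the oriented edges (darts) of `X`:
every edge of `X` occurs once with each of its two orientations, and `M e f = 1` exactly when
the terminal vertex of `e` is the starting vertex of `f` and the starting vertex of `e` is not
the terminal vertex of `f`. -/
def edgeAdjMatrix {V : Type*} [DecidableEq V] (X : SimpleGraph V) :
    Matrix X.Dart X.Dart ℕ :=
  Matrix.of fun e f => if e.snd = f.fst ∧ e.fst ≠ f.snd then 1 else 0

/-- The symmetric edge adjacency matrix `M + Mᵀ`. -/
def symmEdgeAdjMatrix {V : Type*} [DecidableEq V] (X : SimpleGraph V) :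
    Matrix X.Dart X.Dart ℕ :=
  X.edgeAdjMatrix + X.edgeAdjMatrix.transpose

theorem symmEdgeAdjMatrix_isAdjMatrix {V : Type*} [DecidableEq V] (X : SimpleGraph V) :
    X.symmEdgeAdjMatrix.IsAdjMatrix where
  zero_or_one e f := by
    simp only [symmEdgeAdjMatrix, edgeAdjMatrix, Matrix.add_apply, Matrix.transpose_apply,
      Matrix.of_apply]
    split_ifs <;> simp_all
  symm := by
    unfold Matrix.IsSymm
    rw [symmEdgeAdjMatrix, Matrix.transpose_add, Matrix.transpose_transpose, add_comm]
  apply_diag e := by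
    simp only [symmEdgeAdjMatrix, edgeAdjMatrix, Matrix.add_apply, Matrix.transpose_apply,
      Matrix.of_apply]
    split_ifs <;> simp_all

/-- The symmetric edge graph `γ(X)`: the graph whose adjacency matrix is `M + Mᵀ`. -/
def symmEdgeGraph {V : Type*} [DecidableEq V] (X : SimpleGraph V) : SimpleGraph X.Dart :=
  X.symmEdgeAdjMatrix_isAdjMatrix.toGraph

/-- The adjacency relation of `γ(X)`, read off from the matrix. -/
theorem symmEdgeGraph_adj {V : Type*} [DecidableEq V] (X : SimpleGraph V) (e f : X.Dart) :
    X.symmEdgeGraph.Adj e f ↔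
      (e.snd = f.fst ∧ e.fst ≠ f.snd) ∨ (f.snd = e.fst ∧ f.fst ≠ e.snd) := by
  change X.symmEdgeAdjMatrix e f = 1 ↔ _
  simp only [symmEdgeAdjMatrix, edgeAdjMatrix, Matrix.add_apply, Matrix.transpose_apply,
    Matrix.of_apply]
  split_ifs <;> simp_all

end SimpleGraph

/-!
An isomorphism `γ(X) ≃ γ(Y)` puts the oriented edges of `X` and of `Y` on one set of darts, with the
same adjacency but with two reversals `r` and `p`. If `r = p`, the graphs are isomorphic: at a dart
the reversal separates the incoming from the outgoing neighbours, up to exchanging the two, and a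
choice at one dart propagates by connectedness.

Both reversals are automorphisms of the adjacency, hence so is `r ∘ p`. Applied to one of the two
systems on a suitable union of classes of darts only, it leaves the adjacency unchanged and alters
the reversal. When `γ(X)` is disconnected, twisting one component makes the reversals equal. When it
is connected, it is enough to reach `r e = p e` for a single dart `e`: then `r` and `p` either
coincide near `e`, hence everywhere, or commute and become equal after a further twist.

If `r` and `p` differ at every dart, comparing the two sides of each dart shows that they commute
and that a twist achieves `r e = p e`, unless there is a hexagon of `X` that `p` rotates by a half
turn, or one of `Y` that `r` does. In that case, if `r p r = p r p` at some dart, conjugating by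
`r ∘ p` achieves it. Otherwise `X` and `Y` are both a cube with none, two or four edges removed, and
the number of edges tells the cases apart.
-/

/-- An abstract system of darts: `s` and `t` are the starting and terminal vertices of a dart, `r`
is the reversal. The oriented edges of a graph form one; the abstraction allows several systems
on the same type of darts to be compared. -/
structure DartSystem (D V : Type*) where
  s : D → V
  t : D → V
  r : D → D
  s_r : ∀ e, s (r e) = t e
  t_r : ∀ e, t (r e) = s e
  s_ne_t : ∀ e, s e ≠ t e
  ext : ∀ e f, s e = s f → t e = t f → e = f

/-- What the adjacency `A` of darts alone knows of the reversal `p`: two distinct neighbours `f`,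
`g` of a dart lie on the same side of it exactly when `A f (p g)`, and there are only two sides. -/
structure IsReversal {D : Type*} (A : D → D → Prop) (p : D → D) : Prop where
  symm : ∀ {e f}, A e f → A f e
  apply_apply : ∀ e, p (p e) = e
  adj_iff : ∀ e f, A (p e) (p f) ↔ A e f
  ne_self : ∀ e, p e ≠ e
  not_adj_self : ∀ e, ¬ A e (p e)
  not_adj_of_adj : ∀ x e, A x e → ¬ A x (p e)
  side_trans : ∀ e f g h, A e f → A e g → A e h → f ≠ h → A f (p g) → A g (p h) → A f (p h)
  side_pigeonhole : ∀ e f g h, A e f → A e g → A e h → f ≠ g → g ≠ h → f ≠ h →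
    A f (p g) ∨ A g (p h) ∨ A f (p h)

namespace IsReversal

variable {D : Type*} {A : D → D → Prop} {p : D → D}

theorem injective (hp : IsReversal A p) : p.Injective :=
  (show p.Involutive from hp.apply_apply).injective

theorem adj_swap (hp : IsReversal A p) {f g : D} (h : A f (p g)) : A g (p f) := by
  have := (hp.adj_iff _ _).2 (hp.symm h)
  rwa [hp.apply_apply] at this

theorem adj_swap_iff (hp : IsReversal A p) {f g : D} : A f (p g) ↔ A g (p f) :=
  ⟨hp.adj_swap, hp.adj_swap⟩

theorem adj_left_iff (hp : IsReversal A p) {f g : D} : A (p f) g ↔ A f (p g) := by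
  rw [← hp.adj_iff, hp.apply_apply]

theorem side_iff (hp : IsReversal A p) {e x g h : D} (hx : A e x) (hg : A e g) (hh : A e h)
    (hxg : x ≠ g) (hxh : x ≠ h) (hgh : g ≠ h) :
    A g (p h) ↔ (A x (p g) ↔ A x (p h)) := by
  have trans₁ := hp.side_trans e x g h hx hg hh hxh
  have trans₂ := hp.side_trans e x h g hx hh hg hxg
  have trans₃ := hp.side_trans e g x h hg hx hh hgh
  have pigeonhole := hp.side_pigeonhole e x g h hx hg hh hxg hgh hxh
  have swap₁ : A h (p g) ↔ A g (p h) := hp.adj_swap_iff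
  have swap₂ : A x (p g) ↔ A g (p x) := hp.adj_swap_iff
  tauto

end IsReversal

namespace DartSystem

section Basic

variable {D V : Type*} (S : DartSystem D V)

/-- `f` continues `e` without backtracking. -/
def To (e f : D) : Prop := S.t e = S.s f ∧ S.s e ≠ S.t f

/-- Adjacency of darts in the symmetric edge graph. -/
def Adj (e f : D) : Prop := S.To e f ∨ S.To f e

/-- The same darts traversed backwards; it has the same adjacency of darts. -/
def op : DartSystem D V where
  s := S.t
  t := S.s
  r := S.r
  s_r := S.t_r
  t_r := S.s_r
  s_ne_t e := (S.s_ne_t e).symm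
  ext e f h h' := S.ext e f h' h

/-- The graph underlying a dart system. -/
def graph : SimpleGraph V where
  Adj a b := ∃ e, S.s e = a ∧ S.t e = b
  symm := ⟨fun _ _ ⟨e, h, h'⟩ => ⟨S.r e, by rw [S.s_r, h'], by rw [S.t_r, h]⟩⟩
  loopless := ⟨fun _ ⟨e, h, h'⟩ => S.s_ne_t e (h.trans h'.symm)⟩

/-- The pullback of a dart system along a bijection. -/
def comap {D' : Type*} (θ : D' ≃ D) : DartSystem D' V where
  s e := S.s (θ e)
  t e := S.t (θ e)
  r e := θ.symm (S.r (θ e))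
  s_r e := by simp [S.s_r]
  t_r e := by simp [S.t_r]
  s_ne_t e := S.s_ne_t _
  ext e f h h' := θ.injective (S.ext _ _ h h')

variable {S} {e f g x : D}

theorem To.asymm (h : S.To e f) : ¬ S.To f e := by
  simp only [To] at *; grind

theorem Adj.symm (h : S.Adj e f) : S.Adj f e := Or.symm h

theorem Adj.not_to_iff (h : S.Adj e f) : ¬ S.To e f ↔ S.To f e :=
  ⟨h.resolve_left, fun h => h.asymm⟩

theorem op_to : S.op.To e f ↔ S.To f e := by
  simp only [To, op]; grind

theorem op_adj : S.op.Adj = S.Adj := by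
  funext e f; simp only [Adj, op_to]; grind

theorem op_graph : S.op.graph = S.graph := by
  ext a b
  exact ⟨fun ⟨e, h, h'⟩ => S.graph.adj_symm ⟨e, h', h⟩, fun h =>
    let ⟨e, h, h'⟩ := S.graph.adj_symm h; ⟨e, h', h⟩⟩

theorem comap_graph {D' : Type*} (θ : D' ≃ D) : (S.comap θ).graph = S.graph := by
  ext a b
  exact ⟨fun ⟨e, h⟩ => ⟨θ e, h⟩, fun ⟨e, h⟩ => ⟨θ.symm e, by simpa [comap] using h⟩⟩

theorem comap_adj {D' : Type*} (θ : D' ≃ D) (e f : D') :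
    (S.comap θ).Adj e f ↔ S.Adj (θ e) (θ f) := Iff.rfl

theorem r_r (e : D) : S.r (S.r e) = e :=
  S.ext _ _ (by rw [S.s_r, S.t_r]) (by rw [S.t_r, S.s_r])

variable (S) in
/-- Reversal as a permutation. -/
def rPerm : D ≃ D := Function.Involutive.toPerm S.r r_r

theorem r_inj : S.r e = S.r f ↔ e = f := S.rPerm.injective.eq_iff

theorem r_eq_iff : S.r e = f ↔ e = S.r f := by
  rw [← r_inj (S := S), r_r]

theorem r_ne (e : D) : S.r e ≠ e := fun h => S.s_ne_t e (by rw [← S.s_r, h])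

theorem to_r_r : S.To (S.r e) (S.r f) ↔ S.To f e := by
  simp only [To, S.s_r, S.t_r]; grind

theorem adj_r_r : S.Adj (S.r e) (S.r f) ↔ S.Adj e f := by
  simp only [Adj, to_r_r]; grind

theorem s_eq_iff : S.s e = S.s f ↔ e = f ∨ S.To (S.r e) f := by
  have := S.ext e f
  simp only [To, S.s_r, S.t_r]; grind

theorem t_surjective (h : S.s.Surjective) : S.t.Surjective := fun v =>
  let ⟨e, he⟩ := h v
  ⟨S.r e, by rw [S.t_r, he]⟩

theorem not_adj_r (e : D) : ¬ S.Adj e (S.r e) := by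
  simp only [Adj, To, S.s_r, S.t_r]; grind

theorem Adj.not_adj_r (h : S.Adj x e) : ¬ S.Adj x (S.r e) := by
  have := S.s_ne_t e
  have := S.s_ne_t x
  simp only [Adj, To, S.s_r, S.t_r] at *; grind

theorem adj_r_of_to_to (hf : S.To e f) (hg : S.To e g) (h : f ≠ g) : S.Adj f (S.r g) := by
  have := S.ext f g
  simp only [Adj, To, S.s_r, S.t_r] at *; grind

theorem adj_r_of_from_from (hf : S.To f e) (hg : S.To g e) (h : f ≠ g) : S.Adj f (S.r g) := by
  have := S.ext f g
  simp only [Adj, To, S.s_r, S.t_r] at *; grind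

theorem not_adj_r_of_to_from (hf : S.To e f) (hg : S.To g e) : ¬ S.Adj f (S.r g) := by
  simp only [Adj, To, S.s_r, S.t_r] at *; grind

theorem not_adj_r_of_from_to (hf : S.To f e) (hg : S.To e g) : ¬ S.Adj f (S.r g) := by
  simp only [Adj, To, S.s_r, S.t_r] at *; grind

theorem adj_r_iff (hf : S.Adj e f) (hg : S.Adj e g) (h : f ≠ g) :
    S.Adj f (S.r g) ↔ (S.To e f ↔ S.To e g) := by
  rcases hf with hf | hf <;> rcases hg with hg | hg
  · simp [adj_r_of_to_to hf hg h, hf, hg]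
  · simp [not_adj_r_of_to_from hf hg, hf, hg.asymm]
  · simp [not_adj_r_of_from_to hf hg, hg, hf.asymm]
  · simp [adj_r_of_from_from hf hg h, hf.asymm, hg.asymm]

theorem isReversal (S : DartSystem D V) : IsReversal S.Adj S.r where
  symm := Adj.symm
  apply_apply := r_r
  adj_iff _ _ := adj_r_r
  ne_self := r_ne
  not_adj_self := not_adj_r
  not_adj_of_adj _ _ := Adj.not_adj_r
  side_trans e f g h hf hg hh hfh hfg' hgh' := by
    by_cases hfg : f = g
    · rwa [hfg]
    by_cases hgh : g = h
    · rwa [← hgh]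
    rw [adj_r_iff hf hg hfg] at hfg'
    rw [adj_r_iff hg hh hgh] at hgh'
    rw [adj_r_iff hf hh hfh]
    exact hfg'.trans hgh'
  side_pigeonhole e f g h hf hg hh hfg hgh hfh := by
    rw [adj_r_iff hf hg hfg, adj_r_iff hg hh hgh, adj_r_iff hf hh hfh]
    tauto

theorem isReversal_op {p : D → D} (hp : IsReversal S.Adj p) : IsReversal S.op.Adj p := by
  rwa [op_adj]

theorem isReversal_of_adj_iff {W : Type*} {T : DartSystem D W}
    (hA : ∀ e f, S.Adj e f ↔ T.Adj e f) : IsReversal S.Adj T.r := by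
  have : S.Adj = T.Adj := by funext e f; exact propext (hA e f)
  rw [this]; exact T.isReversal

end Basic

end DartSystem

/-- Any two elements are joined by a chain of `R`-steps. -/
def Linked {D : Type*} (R : D → D → Prop) : Prop := ∀ e f, Relation.ReflTransGen R e f

theorem Linked.induction {D : Type*} {R : D → D → Prop} (h : Linked R) {P : D → Prop} {e : D}
    (he : P e) (step : ∀ e f, R e f → P e → P f) (f : D) : P f :=
  (h e f).rec he fun _ hef ih => step _ _ hef ih

theorem Linked.mono {D : Type*} {R R' : D → D → Prop} (h : Linked R)
    (hR : ∀ e f, R e f → R' e f) : Linked R' :=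
  fun e f => Relation.ReflTransGen.mono hR e f (h e f)

namespace DartSystem

section SameReversal

variable {D V W : Type*} {S : DartSystem D V} {T : DartSystem D W} {e f g : D}

/-- Every two darts are joined by steps along adjacencies and reversals. -/
def Connected (S : DartSystem D V) : Prop := Linked fun e f => S.Adj e f ∨ f = S.r e

theorem Connected.of_linked (h : Linked S.Adj) : S.Connected := h.mono fun _ _ => .inl

/-- `S` and `T` orient the adjacencies at `e` alike. -/
def Agree (S : DartSystem D V) (T : DartSystem D W) (e : D) : Prop :=
  ∀ f, S.Adj e f → (S.To e f ↔ T.To e f)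

theorem exists_equiv_of_apply_eq_iff {a : D → V} {b : D → W} (ha : a.Surjective)
    (hb : b.Surjective) (h : ∀ e f, a e = a f ↔ b e = b f) : ∃ φ : V ≃ W, ∀ e, φ (a e) = b e := by
  choose i hi using ha
  have hbi : ∀ e, b (i (a e)) = b e := fun e => (h _ _).1 (hi _)
  refine ⟨.ofBijective (b ∘ i) ⟨fun v w hvw => ?_, fun w => ?_⟩, hbi⟩
  · rw [← hi v, ← hi w]
    exact (h _ _).2 hvw
  · obtain ⟨e, rfl⟩ := hb w
    exact ⟨a e, hbi e⟩

theorem graph_iso_of_s_eq_iff (hs : S.s.Surjective) (ht : T.s.Surjective)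
    (hr : ∀ e, T.r e = S.r e) (h : ∀ e f, S.s e = S.s f ↔ T.s e = T.s f) :
    Nonempty (S.graph ≃g T.graph) := by
  obtain ⟨φ, hφ⟩ := exists_equiv_of_apply_eq_iff hs ht h
  have hφ' : ∀ e, φ (S.t e) = T.t e := fun e => by rw [← S.s_r, hφ, ← hr, T.s_r]
  refine ⟨⟨φ, fun {a b} => ⟨?_, ?_⟩⟩⟩
  · rintro ⟨e, ha, hb⟩
    exact ⟨e, φ.injective (by rw [hφ]; exact ha), φ.injective (by rw [hφ']; exact hb)⟩
  · rintro ⟨e, rfl, rfl⟩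
    exact ⟨e, (hφ e).symm, (hφ' e).symm⟩

theorem graph_iso_of_agree (hs : S.s.Surjective) (ht : T.s.Surjective)
    (hA : ∀ e f, S.Adj e f ↔ T.Adj e f) (hr : ∀ e, T.r e = S.r e) (h : ∀ e, S.Agree T e) :
    Nonempty (S.graph ≃g T.graph) := by
  refine graph_iso_of_s_eq_iff hs ht hr fun e f => ?_
  have : S.To (S.r e) f ↔ T.To (S.r e) f :=
    ⟨fun hef => (h _ _ (.inl hef)).1 hef, fun hef => (h _ _ ((hA _ _).2 (.inl hef))).2 hef⟩
  rw [s_eq_iff, s_eq_iff, hr, this]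

theorem to_iff_to_iff_of_r_eq (hA : ∀ e f, S.Adj e f ↔ T.Adj e f) (hr : ∀ e, T.r e = S.r e)
    (hf : S.Adj e f) (hg : S.Adj e g) :
    (S.To e f ↔ T.To e f) ↔ (S.To e g ↔ T.To e g) := by
  by_cases hfg : f = g
  · rw [hfg]
  have hS := S.adj_r_iff hf hg hfg
  have hT := T.adj_r_iff ((hA _ _).1 hf) ((hA _ _).1 hg) hfg
  rw [hr, ← hA, hS] at hT
  tauto

theorem to_iff_to_comm (hA : ∀ e f, S.Adj e f ↔ T.Adj e f) (h : S.Adj e f) :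
    (S.To e f ↔ T.To e f) ↔ (S.To f e ↔ T.To f e) := by
  rw [← h.not_to_iff, ← ((hA _ _).1 h).not_to_iff, not_iff_not]

theorem Agree.all (hA : ∀ e f, S.Adj e f ↔ T.Adj e f) (hr : ∀ e, T.r e = S.r e)
    (hS : S.Connected) (h : S.Agree T e) : ∀ f, S.Agree T f := by
  refine hS.induction h ?_
  rintro e f (hef | rfl) h g hg
  · exact (to_iff_to_iff_of_r_eq hA hr hef.symm hg).1 ((to_iff_to_comm hA hef).1 (h f hef))
  · have heg : S.Adj e (S.r g) := by rwa [← adj_r_r, r_r]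
    have hto := h _ heg
    rw [← to_r_r, r_r, ← T.to_r_r, hr, hr, r_r] at hto
    exact (to_iff_to_comm hA hg).2 hto

theorem graph_iso_of_r_eq [Nonempty D] (hs : S.s.Surjective) (ht : T.s.Surjective)
    (hS : S.Connected) (hA : ∀ e f, S.Adj e f ↔ T.Adj e f) (hr : ∀ e, T.r e = S.r e) :
    Nonempty (S.graph ≃g T.graph) := by
  obtain ⟨e⟩ := ‹Nonempty D›
  by_cases h : S.Agree T e
  · exact graph_iso_of_agree hs ht hA hr (h.all hA hr hS)
  · obtain ⟨f, hf, hto⟩ : ∃ f, S.Adj e f ∧ ¬ (S.To e f ↔ T.To e f) := by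
      simpa only [Agree, not_forall, exists_prop] using h
    have hA' : ∀ e f, S.Adj e f ↔ T.op.Adj e f := by rw [op_adj]; exact hA
    have h' : S.Agree T.op e := fun g hg => by
      have := to_iff_to_iff_of_r_eq hA hr hf hg
      rw [op_to, ← ((hA _ _).1 hg).not_to_iff]
      tauto
    rw [← T.op_graph]
    exact graph_iso_of_agree hs (t_surjective ht) hA' hr (h'.all hA' hr hS)

end SameReversal

section Match

variable {D V W : Type*} {S : DartSystem D V} {T : DartSystem D W} {p : D → D} {e f : D}

/-- `p` is the reversal of `S` at `e` and at all its neighbours. This local coincidence spreads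
along adjacencies. -/
def Match (S : DartSystem D V) (p : D → D) (e : D) : Prop :=
  p e = S.r e ∧ ∀ f, S.Adj e f → p f = S.r f

theorem match_op : S.op.Match p e ↔ S.Match p e := by
  unfold Match; rw [op_adj]; rfl

theorem Match.eq_r_of_to_of_from (hp : IsReversal S.Adj p) (he : S.Match p e) (hf : S.To e f)
    {k : D} (hk : S.To k f) : p k = S.r k := by
  by_cases hke : k = e
  · rw [hke, he.1]
  have hek : S.Adj e (S.r k) := by
    have := S.ext k e
    simp only [Adj, To, S.s_r, S.t_r] at *; grind
  have hrk := he.2 _ hek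
  rw [r_r] at hrk
  rw [← hrk, hp.apply_apply, hrk]

theorem Match.of_to (hp : IsReversal S.Adj p) (he : S.Match p e) (hf : S.To e f) :
    S.Match p f := by
  have hpf := he.2 f (.inl hf)
  refine ⟨hpf, fun k hk => ?_⟩
  rcases hk with hk | hk
  · have hrpk : S.Adj f (S.r (p k)) := by
      rw [← adj_r_r, r_r, ← hpf, hp.adj_iff]; exact .inl hk
    rcases hrpk with hrpk | hrpk
    · by_contra hne
      have hk_ne : k ≠ S.r (p k) := fun h => hne (by rw [h, r_r, ← h])
      have := adj_r_of_to_to hk hrpk hk_ne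
      rw [r_r] at this
      exact hp.not_adj_self _ this
    · have := he.eq_r_of_to_of_from hp hf hrpk
      rw [r_r] at this
      rw [hp.injective this] at hrpk
      exact absurd hrpk hk.asymm
  · exact he.eq_r_of_to_of_from hp hf hk

theorem Match.of_adj (hp : IsReversal S.Adj p) (he : S.Match p e) (hf : S.Adj e f) :
    S.Match p f := by
  rcases hf with hf | hf
  · exact he.of_to hp hf
  · exact match_op.1 ((match_op.2 he).of_to (isReversal_op hp) (op_to.2 hf))

theorem graph_iso_of_match (hs : S.s.Surjective) (ht : T.s.Surjective)
    (hA : ∀ e f, S.Adj e f ↔ T.Adj e f) (hC : Linked S.Adj) (he : S.Match T.r e) :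
    Nonempty (S.graph ≃g T.graph) :=
  have : Nonempty D := ⟨e⟩
  graph_iso_of_r_eq hs ht (.of_linked hC) hA fun f =>
    (hC.induction he (fun _ _ hef h => h.of_adj (isReversal_of_adj_iff hA) hef) f).1

end Match

section Split

variable {D V W : Type*} {S : DartSystem D V} {T : DartSystem D W}

theorem exists_perm_eq_on_compl {A : D → D → Prop} (hsymm : ∀ {e f}, A e f → A f e)
    (I : D → Prop) (Q : D ≃ D) (hQ : ∀ e f, A (Q e) (Q f) ↔ A e f) (hI : ∀ e, I (Q e) ↔ I e)
    (hcross : ∀ i u, I i → ¬ I u → (A i u ↔ A i (Q u))) :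
    ∃ θ : D ≃ D, (∀ e f, A (θ e) (θ f) ↔ A e f) ∧ (∀ e, I e → θ e = e) ∧
      (∀ e, ¬ I e → θ e = Q e) := by
  classical
  have hI' : ∀ e, I (Q.symm e) ↔ I e := fun e => by rw [← hI, Q.apply_symm_apply]
  refine ⟨⟨fun e => if I e then e else Q e, fun e => if I e then e else Q.symm e,
    fun e => ?_, fun e => ?_⟩, fun e f => ?_, fun e he => by simp [he], fun e he => by simp [he]⟩
  · by_cases h : I e <;> simp [h, hI]
  · by_cases h : I e <;> simp [h, hI']
  · have comm : ∀ e f, A e f ↔ A f e := fun e f => ⟨hsymm, hsymm⟩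
    by_cases he : I e <;> by_cases hf : I f <;> simp only [Equiv.coe_fn_mk, he, hf, if_true,
      if_false]
    · exact (hcross _ _ he hf).symm
    · rw [comm, comm e]; exact (hcross _ _ hf he).symm
    · exact hQ _ _

theorem exists_twist (hA : ∀ e f, S.Adj e f ↔ T.Adj e f) (I : D → Prop)
    (hI : ∀ e, I (T.r (S.r e)) ↔ I e)
    (hcross : ∀ i u, I i → ¬ I u → (S.Adj i u ↔ S.Adj i (T.r (S.r u)))) :
    ∃ θ : D ≃ D, (∀ e f, S.Adj e f ↔ (T.comap θ).Adj e f) ∧ (∀ e, I e → θ e = e) ∧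
      (∀ e, ¬ I e → θ e = T.r (S.r e)) := by
  obtain ⟨θ, hθ, hθI, hθI'⟩ := exists_perm_eq_on_compl (A := S.Adj) Adj.symm I
    (S.rPerm.trans T.rPerm)
    (fun e f => ((isReversal_of_adj_iff hA).adj_iff _ _).trans adj_r_r) hI hcross
  exact ⟨θ, fun e f => by rw [comap_adj, ← hA, hθ], hθI, hθI'⟩

theorem exists_twist_of_comm (hA : ∀ e f, S.Adj e f ↔ T.Adj e f)
    (hcomm : ∀ e, T.r (S.r e) = S.r (T.r e)) (I : D → Prop) (hI : ∀ e, I e → I (T.r (S.r e)))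
    (hcross : ∀ i u, I i → ¬ I u → S.Adj i u → T.r u = S.r u) :
    ∃ θ : D ≃ D, (∀ e f, S.Adj e f ↔ (T.comap θ).Adj e f) ∧ (∀ e, I e → θ e = e) ∧
      (∀ e, ¬ I e → θ e = T.r (S.r e)) := by
  have involutive : ∀ e, T.r (S.r (T.r (S.r e))) = e := fun e => by rw [hcomm e, r_r, T.r_r]
  have hI' : ∀ e, I (T.r (S.r e)) ↔ I e := fun e => ⟨fun h => by
    have := hI _ h
    rwa [involutive] at this, hI e⟩
  have fixed : ∀ u, T.r u = S.r u → T.r (S.r u) = u := fun u hu => by rw [← hu, T.r_r]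
  refine exists_twist hA I hI' fun i u hi hu => ⟨fun h => ?_, fun h => ?_⟩
  · rwa [fixed u (hcross i u hi hu h)]
  · have := fixed _ (hcross i _ hi (by rwa [hI']) h)
    rw [involutive] at this
    rwa [this]

theorem reflTransGen_apply_iff_not {A : D → D → Prop} (hsymm : ∀ {e f}, A e f → A f e) {q : D → D}
    (hqq : ∀ e, q (q e) = e) (hq : ∀ e f, A (q e) (q f) ↔ A e f)
    (hC : Linked fun e f => A e f ∨ f = q e) {e₀ f₀ : D} (hf₀ : ¬ Relation.ReflTransGen A e₀ f₀)
    (x : D) : Relation.ReflTransGen A e₀ (q x) ↔ ¬ Relation.ReflTransGen A e₀ x := by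
  set I := Relation.ReflTransGen A e₀
  have hIA : ∀ {e f}, A e f → I e → I f := fun h h' => h'.tail h
  have cover : ∀ x, I x ∨ I (q x) := by
    refine hC.induction (.inl .refl) ?_
    rintro e f (h | rfl) he
    · exact he.imp (hIA h) (hIA ((hq _ _).2 h))
    · rw [hqq]; exact he.symm
  have hsymmGen : ∀ {x y}, Relation.ReflTransGen A x y → Relation.ReflTransGen A y x :=
    have : Std.Symm A := ⟨fun _ _ => hsymm⟩
    symm_of (Relation.ReflTransGen A)
  have disjoint : ∀ x, I x → ¬ I (q x) := fun x hx hqx => by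
    have hqI : ∀ y, I y → I (q y) := fun y hy =>
      hqx.trans (Relation.ReflTransGen.lift q (fun _ _ => (hq _ _).2) _ _ ((hsymmGen hx).trans hy))
    refine hf₀ ((cover f₀).elim id fun h => ?_)
    have := hqI _ h
    rwa [hqq] at this
  exact ⟨fun h h' => disjoint _ h' h, (cover x).resolve_left⟩

theorem graph_iso_of_not_linked (hs : S.s.Surjective) (ht : T.s.Surjective) (hS : S.Connected)
    (hT : T.Connected) (hA : ∀ e f, S.Adj e f ↔ T.Adj e f) (hC : ¬ Linked S.Adj) :
    Nonempty (S.graph ≃g T.graph) := by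
  have hp := isReversal_of_adj_iff hA
  obtain ⟨e₀, f₀, hf₀⟩ : ∃ e₀ f₀, ¬ Relation.ReflTransGen S.Adj e₀ f₀ := by
    simpa only [Linked, not_forall] using hC
  have : Nonempty D := ⟨e₀⟩
  set I := Relation.ReflTransGen S.Adj e₀
  have hIr : ∀ x, I (S.r x) ↔ ¬ I x :=
    reflTransGen_apply_iff_not Adj.symm r_r (fun _ _ => adj_r_r) hS hf₀
  have hIp : ∀ x, I (T.r x) ↔ ¬ I x :=
    reflTransGen_apply_iff_not Adj.symm r_r hp.adj_iff
      (hT.mono fun e f h => by rwa [hA]) hf₀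
  obtain ⟨θ, hAθ, hθI, hθI'⟩ := exists_twist hA I (fun e => by rw [hIp, hIr, not_not])
    (fun i u hi hu => iff_of_false (fun h => hu (hi.tail h)) fun h => hu (by
      have : I (T.r (S.r u)) := hi.tail h
      rwa [hIp, hIr, not_not] at this))
  rw [← T.comap_graph θ]
  refine graph_iso_of_r_eq hs (ht.comp θ.surjective) hS hAθ fun e => ?_
  change θ.symm (T.r (θ e)) = S.r e
  rw [Equiv.symm_apply_eq]
  by_cases he : I e
  · rw [hθI e he, hθI' (S.r e) (by simp [hIr, he]), r_r]
  · rw [hθI' e he, hθI (S.r e) (by simp [hIr, he]), T.r_r]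

end Split

section Tame

variable {D V : Type*} {S : DartSystem D V} {p : D → D} {e f g h k : D}

/-- `p` preserves the orientation of the adjacencies at `e`. -/
def KeepsTo (S : DartSystem D V) (p : D → D) (e : D) : Prop :=
  ∀ f, S.Adj e f → (S.To e f ↔ S.To (p e) (p f))

/-- `p` reverses `e` as `S` does, but exchanges its incoming and outgoing neighbours with respect
to the reversal of `S`. -/
def Reversed (S : DartSystem D V) (p : D → D) (e : D) : Prop :=
  p e = S.r e ∧ S.KeepsTo p e

/-- `p` determines the same two sides of `e` as the reversal of `S`. -/
def SameSides (S : DartSystem D V) (p : D → D) (e : D) : Prop :=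
  ∀ g h, S.Adj e g → S.Adj e h → g ≠ h → (S.Adj g (p h) ↔ S.Adj g (S.r h))

/-- `p` preserves the orientation at `e` and determines the same sides of `e` as the reversal. -/
def Tame (S : DartSystem D V) (p : D → D) (e : D) : Prop :=
  S.KeepsTo p e ∧ S.SameSides p e

theorem keepsTo_op (hp : IsReversal S.Adj p) : S.op.KeepsTo p e ↔ S.KeepsTo p e := by
  unfold KeepsTo
  rw [op_adj]
  refine forall_congr' fun f => forall_congr' fun hf => ?_
  rw [op_to, op_to, ← hf.not_to_iff, ← ((hp.adj_iff _ _).2 hf).not_to_iff]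
  tauto

theorem reversed_op (hp : IsReversal S.Adj p) : S.op.Reversed p e ↔ S.Reversed p e := by
  unfold Reversed; rw [keepsTo_op hp]; rfl

theorem tame_op (hp : IsReversal S.Adj p) : S.op.Tame p e ↔ S.Tame p e := by
  unfold Tame SameSides; rw [keepsTo_op hp, op_adj]; rfl

theorem KeepsTo.to_of_from (hp : IsReversal S.Adj p) (hf : S.KeepsTo p f) (hk : S.To k f) :
    S.To (p k) (p f) := by
  have hfk : S.Adj f k := .inr hk
  rw [← ((hp.adj_iff _ _).2 hfk).not_to_iff, ← hf k hfk]
  exact hk.asymm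

theorem sameSides_of_neighbor (hp : IsReversal S.Adj p) (hf : S.Adj e f)
    (h : ∀ g, S.Adj e g → g ≠ f → (S.Adj f (p g) ↔ S.Adj f (S.r g))) : S.SameSides p e := by
  intro g k hg hk hgk
  by_cases hgf : f = g
  · rw [← hgf]
    exact h k hk fun hkf => hgk (hgf.symm.trans hkf.symm)
  by_cases hkf : f = k
  · rw [← hkf, hp.adj_swap_iff, S.isReversal.adj_swap_iff]
    exact h g hg (Ne.symm hgf)
  rw [hp.side_iff hf hg hk hgf hkf hgk, S.isReversal.side_iff hf hg hk hgf hkf hgk,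
    h g hg (Ne.symm hgf), h k hk (Ne.symm hkf)]

theorem adj_r_apply (hp : IsReversal S.Adj p) (he : p e = S.r e) (hf : S.Adj e f) :
    S.Adj e (S.r (p f)) := by
  rw [← adj_r_r, r_r, ← he, hp.adj_iff]; exact hf

theorem to_r_apply (hp : IsReversal S.Adj p) (he : p e = S.r e) (hf : S.To e f)
    (hne : p f ≠ S.r f) : S.To (S.r (p f)) e := by
  refine (adj_r_apply hp he (.inl hf)).resolve_left fun h => ?_
  have := adj_r_of_to_to hf h fun h => hne (r_eq_iff.1 h.symm)
  rw [r_r] at this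
  exact hp.not_adj_self _ this

theorem apply_ne_r_of_to (hp : IsReversal S.Adj p) (he : p e = S.r e) (hf : S.To e f)
    (hne : p f ≠ S.r f) (hk : S.Adj e k) : p k ≠ S.r k := by
  intro hpk
  have hrpf := to_r_apply hp he hf hne
  have sides : S.Adj (S.r (p f)) (S.r k) ↔ S.Adj f (S.r k) := by
    rw [adj_r_r, hp.adj_left_iff, hpk]
  rcases hk with hk | hk
  · have hfk : f ≠ k := by rintro rfl; exact hne hpk
    exact not_adj_r_of_from_to hrpf hk (sides.2 (adj_r_of_to_to hf hk hfk))
  · refine not_adj_r_of_to_from hf hk (sides.1 (adj_r_of_from_from hrpf hk ?_))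
    rintro rfl
    rw [r_r] at hpk
    exact hne (r_eq_iff.1 (hp.injective hpk))

theorem apply_ne_r_of_adj (hp : IsReversal S.Adj p) (he : p e = S.r e) (hf : S.Adj e f)
    (hne : p f ≠ S.r f) (hk : S.Adj e k) : p k ≠ S.r k := by
  rcases hf with hf | hf
  · exact apply_ne_r_of_to hp he hf hne hk
  · exact apply_ne_r_of_to (S := S.op) (isReversal_op hp) he (op_to.2 hf) hne (by rwa [op_adj])

theorem reversed_of_apply_ne_r (hp : IsReversal S.Adj p) (he : p e = S.r e) (hf : S.Adj e f)
    (hne : p f ≠ S.r f) : S.Reversed p e := by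
  refine ⟨he, fun k hk => ?_⟩
  have hpk := apply_ne_r_of_adj hp he hf hne hk
  rw [he]
  rcases hk with hk | hk
  · refine iff_of_true hk ?_
    rw [← to_r_r, r_r]
    exact to_r_apply hp he hk hpk
  · refine iff_of_false hk.asymm ?_
    have : S.To e (S.r (p k)) :=
      op_to.1 (to_r_apply (S := S.op) (isReversal_op hp) he (op_to.2 hk) hpk)
    rw [← to_r_r, r_r] at this
    exact this.asymm

theorem Reversed.r_apply_to_iff (he : S.Reversed p e) (hf : S.Adj e f) :
    S.To (S.r (p f)) e ↔ S.To e f := by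
  rw [he.2 f hf, he.1, ← to_r_r, r_r]

theorem Reversed.apply_ne_r (he : S.Reversed p e) (hf : S.Adj e f) : p f ≠ S.r f := fun hpf => by
  have := he.r_apply_to_iff hf
  rw [hpf, r_r] at this
  rcases hf with hf | hf
  · exact hf.asymm (this.2 hf)
  · exact hf.asymm (this.1 hf)

theorem Reversed.comm (hp : IsReversal S.Adj p) (he : S.Reversed p e) (hf : S.Adj e f) :
    p (S.r f) = S.r (p f) := by
  have hrpf := adj_r_apply hp he.1 hf
  have hrprpf := adj_r_apply hp he.1 hrpf
  have same_side : S.To e f ↔ S.To e (S.r (p (S.r (p f)))) := by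
    rw [← not_iff_not, hrprpf.not_to_iff, he.r_apply_to_iff hrpf, ← hrpf.symm.not_to_iff,
      he.r_apply_to_iff hf]
  by_contra hne
  have hf_ne : f ≠ S.r (p (S.r (p f))) := fun h => hne (by
    rw [eq_comm, r_eq_iff] at h
    rw [← h, hp.apply_apply])
  have := (adj_r_iff hf hrprpf hf_ne).2 same_side
  rw [r_r, ← hp.adj_left_iff] at this
  exact not_adj_r _ this

theorem Reversed.r (hp : IsReversal S.Adj p) (he : S.Reversed p e) : S.Reversed p (S.r e) := by
  have hpr : p (S.r e) = e := by rw [← he.1, hp.apply_apply]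
  refine ⟨by rw [hpr, r_r], fun f hf => ?_⟩
  have hrf : S.Adj e (S.r f) := by rwa [← adj_r_r, r_r]
  have hpf : S.Adj e (p f) := by rw [← hpr, hp.adj_iff]; exact hf
  have hcomm := he.comm hp hrf
  rw [r_r] at hcomm
  rw [hpr, ← hpf.symm.not_to_iff, hcomm, he.r_apply_to_iff hrf, hrf.not_to_iff, ← to_r_r, r_r]

theorem Reversed.to_apply_of_to_to (hp : IsReversal S.Adj p) (he : S.Reversed p e)
    (hf : S.To e f) (hg : S.To f g) :
    ¬ S.Adj e (p g) ∧ ¬ S.Adj e (S.r g) ∧ S.To (p f) (p g) := by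
  have hrpf := (he.r_apply_to_iff (.inl hf)).2 hf
  have not_adj_r : ¬ S.Adj e (S.r g) := by
    simp only [Adj, To, S.s_r, S.t_r] at *; grind
  have not_adj : ¬ S.Adj e (p g) := fun h => not_adj_r (by
    have := adj_r_apply hp he.1 h
    rwa [hp.apply_apply] at this)
  refine ⟨not_adj, not_adj_r, ((hp.adj_iff _ _).2 (.inl hg)).resolve_right fun h =>
    not_adj (.inr ?_)⟩
  have hpg_ne : p g ≠ S.r e := fun h => hg.asymm (hp.injective (h.trans he.1.symm) ▸ hf)
  have := S.ext (p g) (S.r e)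
  simp only [To, S.s_r, S.t_r] at *; grind

theorem Reversed.to_apply_of_to_from (hp : IsReversal S.Adj p) (he : S.Reversed p e)
    (hf : S.To e f) (hg : S.To g f) (hge : g ≠ e) :
    S.Adj e (p g) ∧ S.To e (S.r g) ∧ S.To (p g) (p f) := by
  have hrpf := (he.r_apply_to_iff (.inl hf)).2 hf
  have hrg : S.To e (S.r g) := by
    have := S.ext g e
    simp only [To, S.s_r, S.t_r] at *; grind
  have hcomm := he.comm hp (.inl hrg)
  rw [r_r] at hcomm
  have hpg := adj_r_apply hp he.1 (.inl hrg)
  have hpg' := (he.r_apply_to_iff (.inl hrg)).2 hrg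
  rw [← hcomm] at hpg hpg'
  refine ⟨hpg, hrg, ?_⟩
  have hpg_ne : p g ≠ S.r (p f) := fun h => by
    rw [← he.comm hp (.inl hf)] at h
    rw [hp.injective h] at hg
    exact not_adj_r _ (.inr hg)
  have := S.ext (p g) (S.r (p f))
  simp only [To, S.s_r, S.t_r] at *; grind

theorem Reversed.tame_of_to (hp : IsReversal S.Adj p) (he : S.Reversed p e) (hf : S.To e f) :
    S.Tame p f := by
  refine ⟨fun g hg => ?_, sameSides_of_neighbor hp (f := e) (.inr hf) fun g hg hge => ?_⟩
  · by_cases hge : g = e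
    · rw [hge]
      exact iff_of_false hf.asymm (To.asymm ((he.2 f (.inl hf)).1 hf))
    rcases hg with hg | hg
    · exact iff_of_true hg (he.to_apply_of_to_to hp hf hg).2.2
    · exact iff_of_false hg.asymm (he.to_apply_of_to_from hp hf hg hge).2.2.asymm
  · rcases hg with hg | hg
    · obtain ⟨not_adj, not_adj_r, -⟩ := he.to_apply_of_to_to hp hf hg
      exact iff_of_false not_adj not_adj_r
    · obtain ⟨adj, hrg, -⟩ := he.to_apply_of_to_from hp hf hg hge
      exact iff_of_true adj (.inl hrg)

theorem Reversed.tame (hp : IsReversal S.Adj p) (he : S.Reversed p e) (hf : S.Adj e f) :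
    S.Tame p f := by
  rcases hf with hf | hf
  · exact he.tame_of_to hp hf
  · exact (tame_op hp).1
      (((reversed_op hp).2 he).tame_of_to (S := S.op) (isReversal_op hp) (op_to.2 hf))

theorem Tame.apply_eq_r_or (hp : IsReversal S.Adj p) (hf : S.Tame p f) (hg : S.To g f)
    (hk : S.To k f) (hne : g ≠ k) : p g = S.r g ∨ p k = S.r k := by
  have hgk : S.Adj g (p k) :=
    (hf.2 g k (.inr hg) (.inr hk) hne).2 (adj_r_of_from_from hg hk hne)
  have hkg := hp.adj_swap hgk
  have hpg := hf.1.to_of_from hp hg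
  have hpk := hf.1.to_of_from hp hk
  have hpg_ne : p g ≠ p k := fun h => hne (hp.injective h)
  have := S.ext (p g) (S.r g)
  have := S.ext (p k) (S.r k)
  have := S.ext g k
  have := S.ext (p g) (p k)
  simp only [Adj, To, S.s_r, S.t_r] at *
  grind

theorem Tame.reversed_of_from (hp : IsReversal S.Adj p) (hf : S.Tame p f) (hk : S.To k f)
    (hpk : p k = S.r k) : S.Reversed p k := by
  refine reversed_of_apply_ne_r hp hpk (.inl hk) fun hpf => ?_
  have := hf.1.to_of_from hp hk
  rw [hpk, hpf, to_r_r] at this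
  exact hk.asymm this

theorem eq_of_to_of_unique_from (hk : S.To k f) (hu : ∀ k', S.To k' f → k' = k) (hg : S.To k g) :
    g = f := by
  by_contra hne
  have hrg : S.To (S.r g) f := by
    have := S.ext g f
    simp only [To, S.s_r, S.t_r] at *; grind
  rw [← hu _ hrg] at hg
  exact not_adj_r g (.inr hg)

theorem Tame.tame_of_unique_from (hp : IsReversal S.Adj p) (hf : S.Tame p f) (hk : S.To k f)
    (hu : ∀ k', S.To k' f → k' = k) : S.Tame p k := by
  have hpk := hf.1.to_of_from hp hk
  have to_unique : ∀ {g}, S.To k g → g = f := fun hg => eq_of_to_of_unique_from hk hu hg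
  have apply_to_unique : ∀ {g}, S.To (p k) g → g = p f := fun hg => by
    refine eq_of_to_of_unique_from hpk (fun k' hk' => ?_) hg
    have hfk' : S.Adj f (p k') := by rw [← hp.adj_left_iff]; exact .inr hk'
    have hpk' : S.To (p k') f := by
      rw [← hfk'.not_to_iff, hf.1 _ hfk', hp.apply_apply]
      exact hk'.asymm
    rw [← hu _ hpk', hp.apply_apply]
  refine ⟨fun g hg => ?_, sameSides_of_neighbor hp (f := f) (.inl hk) fun g hg hgf => ?_⟩
  · rcases hg with hg | hg
    · rw [to_unique hg]; exact iff_of_true hk hpk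
    · refine iff_of_false hg.asymm fun h => ?_
      rw [hp.injective (apply_to_unique h)] at hg
      exact hg.asymm hk
  have hgk : S.To g k := hg.not_to_iff.1 fun h => hgf (to_unique h)
  refine iff_of_false (fun h => ?_) (not_adj_r_of_to_from hk hgk)
  have hk_ne : k ≠ p g := fun h => by
    rw [h] at hgk
    exact hp.not_adj_self _ (.inl hgk)
  rcases h with h | h
  · have := (hf.2 k (p g) (.inr hk) (.inl h) hk_ne).1 (by rw [hp.apply_apply]; exact .inr hgk)
    exact not_adj_r_of_from_to hk h this
  · exact hk_ne (hu _ h).symm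

theorem Tame.reversed_or_tame_of_from (hp : IsReversal S.Adj p) (hf : S.Tame p f)
    (hk : S.To k f) : S.Reversed p k ∨ S.Tame p k := by
  by_cases hpk : p k = S.r k
  · exact .inl (hf.reversed_of_from hp hk hpk)
  refine .inr ?_
  by_cases hu : ∀ k', S.To k' f → k' = k
  · exact hf.tame_of_unique_from hp hk hu
  push Not at hu
  obtain ⟨k', hk', hne⟩ := hu
  have hpk' := (hf.apply_eq_r_or hp hk hk' hne.symm).resolve_left hpk
  refine ((hf.reversed_of_from hp hk' hpk').r hp).tame hp (.inr ?_)
  have := S.ext k k'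
  simp only [To, S.s_r, S.t_r] at *; grind

theorem reversed_or_tame (hp : IsReversal S.Adj p) (hC : Linked S.Adj) (he : S.Reversed p e) :
    ∀ f, S.Reversed p f ∨ S.Tame p f := by
  refine hC.induction (.inl he) ?_
  rintro f g hg (hf | hf)
  · exact .inr (hf.tame hp hg)
  rcases hg with hg | hg
  · have := ((tame_op hp).2 hf).reversed_or_tame_of_from (S := S.op) (isReversal_op hp) (op_to.2 hg)
    rwa [reversed_op hp, tame_op hp] at this
  · exact hf.reversed_or_tame_of_from hp hg

theorem apply_r_of_to (hp : IsReversal S.Adj p) (hk : ∀ e, S.KeepsTo p e) (hf : S.To e f)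
    (he : p (S.r e) = S.r (p e)) : p (S.r f) = S.r (p f) := by
  have hpf := (hk e f (.inl hf)).1 hf
  have hprf := (hk _ _ (.inl (to_r_r.2 hf))).1 (to_r_r.2 hf)
  rw [he, ← to_r_r, r_r] at hprf
  by_contra hne
  have := adj_r_of_to_to hpf hprf (fun h => hne (by rw [h, r_r]))
  rw [r_r, hp.adj_iff] at this
  exact not_adj_r _ this

theorem apply_r_of_keepsTo (hp : IsReversal S.Adj p) (hC : Linked S.Adj)
    (hk : ∀ e, S.KeepsTo p e) (he : p (S.r e) = S.r (p e)) : ∀ f, p (S.r f) = S.r (p f) := by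
  refine hC.induction he ?_
  rintro e f (hf | hf) he
  · exact apply_r_of_to hp hk hf he
  · exact apply_r_of_to (S := S.op) (isReversal_op hp) (fun e => (keepsTo_op hp).2 (hk e))
      (op_to.2 hf) he

end Tame

section CommonReversal

variable {D V W : Type*} {S : DartSystem D V} {T : DartSystem D W} {e f : D}

/-- The orientations of `S` and `T` agree at `e` and are opposite at the reversal of `e`. -/
def Aligned (S : DartSystem D V) (T : DartSystem D W) (e : D) : Prop :=
  S.Agree T e ∧ S.Agree T.op (S.r e)

theorem Tame.agree_iff (hA : ∀ e f, S.Adj e f ↔ T.Adj e f) (he : S.Tame T.r e)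
    (hf : S.Adj e f) : S.Agree T e ↔ (S.To e f ↔ T.To e f) := by
  refine ⟨fun h => h f hf, fun h g hg => ?_⟩
  by_cases hfg : f = g
  · rwa [← hfg]
  have sides := he.2 f g hf hg hfg
  rw [adj_r_iff hf hg hfg, hA, T.adj_r_iff ((hA _ _).1 hf) ((hA _ _).1 hg) hfg] at sides
  tauto

theorem Tame.agree_op_iff (hA : ∀ e f, S.Adj e f ↔ T.Adj e f) (he : S.Tame T.r e)
    (hf : S.Adj e f) : S.Agree T.op e ↔ (S.To e f ↔ T.To f e) := by
  rw [Tame.agree_iff (T := T.op) (by rwa [op_adj]) he hf, op_to]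

theorem Agree.op_apply (hA : ∀ e f, S.Adj e f ↔ T.Adj e f) (hk : ∀ e, S.KeepsTo T.r e)
    (h : S.Agree T e) : S.Agree T.op (T.r e) := by
  intro g hg
  have hg' : S.Adj e (T.r g) := by rwa [← (isReversal_of_adj_iff hA).adj_left_iff]
  have := hk e _ hg'
  rw [T.r_r] at this
  rw [op_to, ← this, ← T.to_r_r, T.r_r]
  exact h _ hg'

theorem Aligned.apply_r (hA : ∀ e f, S.Adj e f ↔ T.Adj e f) (hk : ∀ e, S.KeepsTo T.r e)
    (hcomm : ∀ e, T.r (S.r e) = S.r (T.r e)) (h : S.Aligned T e) :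
    S.Aligned T (T.r (S.r e)) := by
  refine ⟨h.2.op_apply (T := T.op) (by rwa [op_adj]) hk, ?_⟩
  rw [hcomm, r_r]
  exact h.1.op_apply hA hk

theorem Aligned.of_adj (hA : ∀ e f, S.Adj e f ↔ T.Adj e f) (he : S.Aligned T e)
    (hef : S.Adj e f) (hf : S.Tame T.r f) (hrf : S.Tame T.r (S.r f)) : S.Aligned T f := by
  have hre := he.2 (S.r f) (adj_r_r.2 hef)
  refine ⟨(hf.agree_iff hA hef.symm).2 ((to_iff_to_comm hA hef).1 (he.1 f hef)),
    (hrf.agree_op_iff hA (adj_r_r.2 hef.symm)).2 ?_⟩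
  rw [op_to] at hre
  rw [← (adj_r_r.2 hef).not_to_iff, hre, ((hA _ _).1 (adj_r_r.2 hef)).symm.not_to_iff]

theorem Reversed.of_adj_iff (hA : ∀ e f, S.Adj e f ↔ T.Adj e f) (he : S.Reversed T.r e) :
    T.Reversed S.r e :=
  ⟨he.1.symm, fun f hf => (reversed_of_apply_ne_r
    (isReversal_of_adj_iff fun e f => (hA e f).symm) he.1.symm hf
    (he.apply_ne_r ((hA _ _).2 hf)).symm).2 f hf⟩

theorem Reversed.aligned_iff (hA : ∀ e f, S.Adj e f ↔ T.Adj e f) (he : S.Reversed T.r e)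
    (hf : S.Adj e f) : S.Aligned T f ↔ (S.To f e ↔ T.To f e) := by
  have hp := isReversal_of_adj_iff hA
  rw [Aligned, (he.tame hp hf).agree_iff hA hf.symm,
    ((he.r hp).tame hp (adj_r_r.2 hf)).agree_op_iff hA (adj_r_r.2 hf.symm), to_r_r,
    ← (he.of_adj_iff hA).2 f ((hA _ _).1 hf), to_iff_to_comm hA hf, and_self]

theorem Reversed.aligned_r_iff (hA : ∀ e f, S.Adj e f ↔ T.Adj e f) (he : S.Reversed T.r e)
    (hf : S.Adj e f) : S.Aligned T (S.r f) ↔ ¬ S.Aligned T f := by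
  rw [(he.r (isReversal_of_adj_iff hA)).aligned_iff hA (adj_r_r.2 hf), he.aligned_iff hA hf,
    to_r_r, ← ((hA _ _).1 (adj_r_r.2 hf)).not_to_iff, ← (he.of_adj_iff hA).2 f ((hA _ _).1 hf),
    to_iff_to_comm hA hf.symm]
  tauto

theorem match_comap_of_aligned (hA : ∀ e f, S.Adj e f ↔ T.Adj e f) (he : S.Reversed T.r e)
    {θ : D ≃ D} (hθ : ∀ f, S.Aligned T f → θ f = f)
    (hθ' : ∀ f, ¬ S.Aligned T f → θ f = T.r (S.r f)) : S.Match (T.comap θ).r e := by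
  have fixed : ∀ f, T.r (S.r f) = f → θ f = f := fun f hf => by
    by_cases h : S.Aligned T f
    · exact hθ f h
    · rw [hθ' f h, hf]
  refine ⟨?_, fun f hf => ?_⟩ <;> simp only [comap, Equiv.symm_apply_eq]
  · rw [fixed e (by rw [← he.1, T.r_r]), fixed (S.r e) (by rw [r_r, he.1]), he.1]
  · have hr := he.aligned_r_iff hA hf
    by_cases h : S.Aligned T f
    · rw [hθ f h, hθ' _ fun h' => hr.1 h' h, r_r]
    · rw [hθ' f h, hθ _ (hr.2 h), T.r_r]

theorem graph_iso_of_common_reversal (hs : S.s.Surjective) (ht : T.s.Surjective)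
    (hA : ∀ e f, S.Adj e f ↔ T.Adj e f) (hC : Linked S.Adj) (he : T.r e = S.r e) :
    Nonempty (S.graph ≃g T.graph) := by
  have hp := isReversal_of_adj_iff hA
  by_cases hm : S.Match T.r e
  · exact graph_iso_of_match hs ht hA hC hm
  obtain ⟨f, hf, hne⟩ : ∃ f, S.Adj e f ∧ T.r f ≠ S.r f := by
    simpa only [Match, he, true_and, not_forall, exists_prop] using hm
  have hR := reversed_of_apply_ne_r hp he hf hne
  have hRT := reversed_or_tame hp hC hR
  have hk : ∀ e, S.KeepsTo T.r e := fun e => (hRT e).elim (·.2) (·.1)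
  have hcomm := apply_r_of_keepsTo hp hC hk (e := e) (by rw [he, r_r, ← he, T.r_r])
  have tame : ∀ e, T.r e ≠ S.r e → S.Tame T.r e := fun e he =>
    (hRT e).resolve_left fun h => he h.1
  obtain ⟨θ, hAθ, hθ, hθ'⟩ := exists_twist_of_comm hA hcomm (S.Aligned T)
    (fun e h => h.apply_r hA hk hcomm) (fun i u hi hu hiu => by
      by_contra hne
      exact hu (hi.of_adj hA hiu (tame u hne) (tame _ fun h => hne (by
        rwa [hcomm, r_inj] at h))))
  rw [← T.comap_graph θ]
  exact graph_iso_of_match hs (ht.comp θ.surjective) hAθ hC (match_comap_of_aligned hA hR hθ hθ')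

end CommonReversal

section Local

variable {D V : Type*} {S : DartSystem D V} {p : D → D} {e f g h : D}

theorem fork_cases (hp : IsReversal S.Adj p) (hf : S.To e f) (hg : S.To e g)
    (hfg : f ≠ g) (hside : S.Adj f (p g)) :
    p e = S.r e ∨ p f = S.r f ∨ p g = S.r g ∨
    (S.s (p f) = S.t g ∧ S.s (p g) = S.t f ∧ S.t (p f) = S.s (p e) ∧ S.t (p g) = S.s (p e)) ∨
    (S.s (p f) = S.t g ∧ S.s (p g) = S.t f ∧ S.t (p g) = S.s (p e) ∧ S.t (p e) = S.t g) ∨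
    (S.s (p f) = S.t g ∧ S.s (p g) = S.t f ∧ S.t (p f) = S.s (p e) ∧ S.t (p e) = S.t f) := by
  have hside' := hp.adj_swap hside
  have he := hp.not_adj_self e
  have hf' := hp.not_adj_self f
  have hg' := hp.not_adj_self g
  have hef := (hp.adj_iff e f).2 (.inl hf)
  have heg := (hp.adj_iff e g).2 (.inl hg)
  have ext_e := S.ext (p e) (S.r e)
  have ext_f := S.ext (p f) (S.r f)
  have ext_g := S.ext (p g) (S.r g)
  have ext_fg := S.ext f g
  simp only [Adj, To, S.s_r, S.t_r] at *
  grind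

theorem path_cases (hp : IsReversal S.Adj p) (hf : S.To e f) (hh : S.To h e)
    (hside : S.Adj f (p h)) :
    p e = S.r e ∨
    (S.t (p h) = S.t e ∧ S.s (p f) = S.s e ∧ S.s (p e) = S.t (p f) ∧ S.t (p e) = S.s (p h)) ∨
    (S.s (p h) = S.t f ∧ S.t (p f) = S.s h ∧ S.s (p e) = S.t (p h) ∧ S.t (p e) = S.s (p f)) ∨
    (S.s (p h) = S.t f ∧ S.t (p f) = S.s h ∧ S.s (p e) = S.s h ∧ S.t (p e) = S.t f) ∨
    (S.t (p h) = S.t e ∧ S.t (p f) = S.s h ∧ S.s (p e) = S.s h ∧ S.t (p e) = S.s (p h)) ∨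
    (S.t (p h) = S.t e ∧ S.t (p f) = S.s h ∧ S.s (p f) = S.s (p h) ∧ S.t (p e) = S.s (p h)) ∨
    (S.s (p h) = S.t f ∧ S.s (p f) = S.s e ∧ S.s (p e) = S.t (p f) ∧ S.t (p e) = S.t f) ∨
    (S.s (p h) = S.t f ∧ S.s (p f) = S.s e ∧ S.t (p f) = S.t (p h) ∧ S.s (p e) = S.t (p h)) := by
  have hside' := hp.adj_swap hside
  have he := hp.not_adj_self e
  have hf' := hp.not_adj_self f
  have hh' := hp.not_adj_self h
  have hef := (hp.adj_iff e f).2 (.inl hf)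
  have heh := (hp.adj_iff e h).2 (.inr hh)
  have ext_e := S.ext (p e) (S.r e)
  simp only [Adj, To, S.s_r, S.t_r] at *
  grind (splits := 40)

/-- The darts `f` and `h` leave and enter `e` on the same side with respect to `p`, and `e`, `p f`,
`p e`, `p h` are the sides of a square: one of the configurations of `path_cases`, which turns out
to be impossible. -/
structure Square (S : DartSystem D V) (p : D → D) (e f h : D) : Prop where
  out : S.To e f
  into : S.To h e
  side : S.Adj f (p h)
  t_h : S.t (p h) = S.t e
  s_f : S.s (p f) = S.s e
  s_e : S.s (p e) = S.t (p f)
  t_e : S.t (p e) = S.s (p h)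

namespace Square

theorem s_apply_ne (hq : S.Square p e f h) (hp : IsReversal S.Adj p) : S.s (p e) ≠ S.t e := by
  rcases (hp.adj_iff e h).2 (.inr hq.into) with heh | heh
  · exact hq.t_h ▸ heh.2
  · exact absurd hq.t_e.symm heh.2

theorem t_apply_ne (hq : S.Square p e f h) (hp : IsReversal S.Adj p) : S.t (p e) ≠ S.s e := by
  rcases (hp.adj_iff e f).2 (.inl hq.out) with hef | hef
  · exact absurd hq.s_e hef.2
  · exact hq.s_f ▸ hef.2.symm

theorem to_r_apply (hq : S.Square p e f h) (hp : IsReversal S.Adj p) : S.To e (S.r (p h)) :=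
  ⟨by rw [S.s_r, hq.t_h], by rw [S.t_r, ← hq.t_e]; exact (hq.t_apply_ne hp).symm⟩

theorem r_apply_to (hq : S.Square p e f h) (hp : IsReversal S.Adj p) : S.To (S.r (p f)) e :=
  ⟨by rw [S.t_r, hq.s_f], by rw [S.s_r, ← hq.s_e]; exact hq.s_apply_ne hp⟩

theorem ne_r_apply (hq : S.Square p e f h) : f ≠ S.r (p h) := fun hk =>
  not_adj_r (p h) (hk ▸ hq.side).symm

theorem not_adj (hq : S.Square p e f h) (hp : IsReversal S.Adj p) (hne : ∀ e, p e ≠ S.r e) :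
    ¬ S.Adj (S.r (p h)) (p f) := fun hk =>
  not_adj_r _ (hp.side_trans e _ f h (.inl (hq.to_r_apply hp)) (.inl hq.out) (.inr hq.into)
    (fun hkh => hne h (r_eq_iff.1 hkh)) hk hq.side).symm

theorem ends (hq : S.Square p e f h) (hp : IsReversal S.Adj p) (hne : ∀ e, p e ≠ S.r e) :
    S.s (p (S.r (p f))) = S.t (S.r (p h)) ∧ S.t (p (S.r (p h))) = S.s (S.r (p f)) := by
  have hk := hq.to_r_apply hp
  have hl := hq.r_apply_to hp
  have hkl : S.Adj (S.r (p h)) (p (S.r (p f))) := by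
    rcases hp.side_pigeonhole e _ _ f (.inl hk) (.inr hl) (.inl hq.out)
      (fun heq => hk.asymm (heq ▸ hl)) (fun heq => hne f (r_eq_iff.1 heq)) hq.ne_r_apply.symm
      with hkl | hlf | hkf
    · exact hkl
    · exact absurd hlf.symm (not_adj_r _)
    · exact absurd hkf (hq.not_adj hp hne)
  have := path_cases hp hk hl hkl
  have := hq.s_e
  have := hq.t_e
  simp only [Adj, To, S.s_r, S.t_r] at *
  grind

theorem apply_to (hq : S.Square p e f h) (hp : IsReversal S.Adj p) (hne : ∀ e, p e ≠ S.r e) :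
    S.To (p f) (S.r (p (S.r (p h)))) := by
  have ends_h := (hq.ends hp hne).2
  rw [S.s_r] at ends_h
  exact ⟨by rw [S.s_r, ends_h], fun hs => hq.ne_r_apply
    (hp.injective (S.ext _ _ (by rw [hs, S.t_r]) ends_h.symm))⟩

theorem r_to_apply (hq : S.Square p e f h) (hp : IsReversal S.Adj p) : S.To (S.r e) (p f) :=
  ⟨by rw [S.t_r, hq.s_f], by rw [S.s_r, ← hq.s_e]; exact (hq.s_apply_ne hp).symm⟩

theorem adj_apply (hq : S.Square p e f h) (hp : IsReversal S.Adj p) :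
    S.Adj (p e) (p (S.r (p h))) :=
  (hp.adj_iff e _).2 (.inl (hq.to_r_apply hp))

theorem not_adj_r_apply (hq : S.Square p e f h) (hp : IsReversal S.Adj p)
    (hne : ∀ e, p e ≠ S.r e) : ¬ S.Adj (S.r (p (S.r (p h)))) e := by
  have hm := hq.apply_to hp hne
  have := hq.s_apply_ne hp
  have := hq.s_f
  have := hq.s_e
  simp only [Adj, To, S.s_r, S.t_r] at *
  grind

theorem r_apply_ne (hq : S.Square p e f h) (hp : IsReversal S.Adj p) :
    S.r (p (S.r (p h))) ≠ p e := fun heq =>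
  not_adj_r _ ((r_eq_iff.1 heq) ▸ hq.adj_apply hp)

theorem r_apply_side (hq : S.Square p e f h) (hp : IsReversal S.Adj p)
    (hne : ∀ e, p e ≠ S.r e) : S.Adj (S.r (p (S.r (p h)))) (p (S.r e)) := by
  have hm := hq.apply_to hp hne
  have hj := hq.r_to_apply hp
  rcases hp.side_pigeonhole (p f) _ (S.r e) (p e) (.inl hm) (.inr hj)
    ((hp.adj_iff _ _).2 (.inl hq.out)).symm (fun heq => hj.asymm (heq ▸ hm)) (hne e).symm
    (hq.r_apply_ne hp) with hij | hje | hie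
  · exact hij
  · rw [hp.apply_apply] at hje
    exact absurd hje.symm (not_adj_r _)
  · rw [hp.apply_apply] at hie
    exact absurd hie (hq.not_adj_r_apply hp hne)

theorem next_cases (hq : S.Square p e f h) (hp : IsReversal S.Adj p) (hne : ∀ e, p e ≠ S.r e) :
    S.t (p (S.r (p (S.r (p h))))) = S.t e ∨
      S.s (p (S.r e)) = S.t f ∧ S.t (p (S.r e)) = S.t (p f) := by
  have cases := (path_cases hp (hq.apply_to hp hne) (hq.r_to_apply hp)
    (hq.r_apply_side hp hne)).resolve_left (hne _)
  rw [hp.apply_apply] at cases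
  have := hq.out.1
  simp only [S.s_r, S.t_r] at *
  grind

theorem t_apply_r_apply_ne (hq : S.Square p e f h) (hp : IsReversal S.Adj p)
    (hne : ∀ e, p e ≠ S.r e) : S.t (p (S.r (p (S.r (p h))))) ≠ S.t e := fun ends_e => by
  have hk := hq.to_r_apply hp
  have hn : S.To e (S.r (p (S.r (p (S.r (p h)))))) := by
    refine ⟨by rw [S.s_r, ends_e], fun hs => hq.r_apply_ne hp ?_⟩
    rw [← S.ext _ e (by rw [hs, S.t_r]) ends_e, hp.apply_apply]
  have ne_k : S.r (p (S.r (p (S.r (p h))))) ≠ S.r (p h) := fun heq =>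
    hq.not_adj_r_apply hp hne (by
      rw [hp.injective (r_inj.1 heq)]
      exact .inl hq.into)
  have ne_f : S.r (p (S.r (p (S.r (p h))))) ≠ f := fun heq => not_adj_r f (by
    rw [← r_eq_iff.1 heq, ← hp.adj_left_iff]
    exact .inl (hq.apply_to hp hne))
  rcases hp.side_pigeonhole e _ (S.r (p h)) f (.inl hn) (.inl hk) (.inl hq.out) ne_k
    hq.ne_r_apply.symm ne_f with hnk | hkf | hnf
  · refine hp.not_adj_self (S.r (p (S.r (p h)))) (Adj.symm ?_)
    rwa [← adj_r_r, r_r] at hnk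
  · exact hq.not_adj hp hne hkf
  · have := hq.s_apply_ne hp
    have := hq.s_f
    have := hq.s_e
    simp only [Adj, To, S.s_r, S.t_r] at *
    grind

theorem t_apply_r_ne (hq : S.Square p e f h) (hp : IsReversal S.Adj p)
    (hne : ∀ e, p e ≠ S.r e) (ends_e : S.s (p (S.r e)) = S.t f) :
    S.t (p (S.r e)) ≠ S.t (p f) := fun ends_f => by
  have hn : S.To (p f) (S.r (p (S.r e))) :=
    ⟨by rw [S.s_r, ends_f], by rw [S.t_r, ends_e, hq.s_f]; exact hq.out.2⟩
  have ne_apply_e : S.r (p (S.r e)) ≠ p e := fun heq =>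
    hq.ne_r_apply (S.ext _ _ (by rw [S.s_r, hq.t_h, hq.out.1])
      (by rw [S.t_r, ← hq.t_e, ← heq, S.t_r, ends_e]))
  rcases hp.side_pigeonhole (p f) _ (S.r e) (p e) (.inl hn) (.inr (hq.r_to_apply hp))
    ((hp.adj_iff _ _).2 (.inl hq.out)).symm (fun heq => hne _ (r_eq_iff.1 heq)) (hne e).symm
    ne_apply_e with hnj | hje | hne'
  · exact not_adj_r _ hnj.symm
  · rw [hp.apply_apply] at hje
    exact not_adj_r _ hje.symm
  · rw [hp.apply_apply] at hne'
    have := hq.out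
    have := hq.s_apply_ne hp
    have := hq.s_e
    simp only [Adj, To, S.s_r, S.t_r] at *
    grind

theorem elim (hq : S.Square p e f h) (hp : IsReversal S.Adj p) (hne : ∀ e, p e ≠ S.r e) :
    False := by
  rcases hq.next_cases hp hne with ends_e | ⟨ends_e, ends_f⟩
  · exact hq.t_apply_r_apply_ne hp hne ends_e
  · exact hq.t_apply_r_ne hp hne ends_e ends_f

end Square

theorem fork_ends (hp : IsReversal S.Adj p) (hne : ∀ e, p e ≠ S.r e) (hf : S.To e f)
    (hg : S.To e g) (hfg : f ≠ g) (hside : S.Adj f (p g)) :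
    S.s (p f) = S.t g ∧ S.s (p g) = S.t f ∧ S.t (p f) = S.s (p e) ∧ S.t (p g) = S.s (p e) := by
  have square {f g} (hf : S.To e f) (hg : S.To e g) (hside : S.Adj f (p g))
      (s_f : S.s (p f) = S.t g) (s_g : S.s (p g) = S.t f) (t_g : S.t (p g) = S.s (p e))
      (t_e : S.t (p e) = S.t g) : S.Square p g (p f) e :=
    ⟨(hp.adj_swap hside).resolve_right fun hfg => hfg.2 s_f, hg, (hp.adj_iff _ _).2 (.inr hf), t_e,
      by rw [hp.apply_apply, ← hf.1, hg.1], by rw [hp.apply_apply, s_g], t_g⟩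
  rcases fork_cases hp hf hg hfg hside with he | hf' | hg' | ends | ⟨s_f, s_g, t_g, t_e⟩ |
    ⟨s_f, s_g, t_f, t_e⟩
  · exact absurd he (hne e)
  · exact absurd hf' (hne f)
  · exact absurd hg' (hne g)
  · exact ends
  · exact ((square hf hg hside s_f s_g t_g t_e).elim hp hne).elim
  · exact ((square hg hf (hp.adj_swap hside) s_g s_f t_f t_e).elim hp hne).elim

theorem path_ends (hp : IsReversal S.Adj p) (hne : ∀ e, p e ≠ S.r e) (hf : S.To e f)
    (hh : S.To h e) (hside : S.Adj f (p h)) :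
    (S.s (p h) = S.t f ∧ S.t (p f) = S.s h ∧ S.s (p e) = S.t (p h) ∧ S.t (p e) = S.s (p f)) ∨
    (S.t (p h) = S.t e ∧ S.t (p f) = S.s h ∧ S.s (p e) = S.s h ∧ S.t (p e) = S.s (p h)) ∨
    (S.s (p h) = S.t f ∧ S.s (p f) = S.s e ∧ S.s (p e) = S.t (p f) ∧ S.t (p e) = S.t f) := by
  have hef := (hp.adj_iff e f).2 (.inl hf)
  have heh := (hp.adj_iff e h).2 (.inr hh)
  have not_square {e f h} (hq : S.Square p e f h) : False := hq.elim hp hne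
  rcases path_cases hp hf hh hside with he | ⟨t_h, s_f, s_e, t_e⟩ | ends |
    ⟨s_h, t_f, s_e, t_e⟩ | ends | ⟨t_h, t_f, s_f, t_e⟩ | ends | ⟨s_h, s_f, t_f, s_e⟩
  · exact absurd he (hne e)
  · exact (not_square ⟨hf, hh, hside, t_h, s_f, s_e, t_e⟩).elim
  · exact .inl ends
  · exact (not_square (e := p e) (f := p h) (h := p f)
      ⟨heh.resolve_right fun hhe => hhe.2 (s_h.trans t_e.symm),
        hef.resolve_left fun hfe => hfe.2 (s_e.trans t_f.symm),
        by rw [hp.apply_apply]; exact hside.symm,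
        by rw [hp.apply_apply, t_e], by rw [hp.apply_apply, s_e],
        by rw [hp.apply_apply, hp.apply_apply, hh.1],
        by rw [hp.apply_apply, hp.apply_apply, hf.1]⟩).elim
  · exact .inr (.inl ends)
  · exact (not_square (e := p h) (f := f) (h := p e)
      ⟨hside.symm.resolve_right fun hfh => hfh.2 (hf.1.symm.trans t_h.symm),
        heh.resolve_right fun hhe => hhe.2 t_e.symm,
        by rw [hp.apply_apply]; exact .inr hf,
        by rw [hp.apply_apply, t_h], s_f, by rw [hp.apply_apply, t_f],
        by rw [hp.apply_apply, hp.apply_apply, hh.1]⟩).elim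
  · exact .inr (.inr ends)
  · exact (not_square (e := p f) (f := p e) (h := h)
      ⟨hef.resolve_left fun hfe => hfe.2 (s_e.trans t_f.symm),
        (hp.adj_swap hside).resolve_right fun hfh => hfh.2 (s_f.trans hh.1.symm),
        (hp.adj_iff _ _).2 (.inr hh), t_f.symm, by rw [hp.apply_apply, s_f],
        by rw [hp.apply_apply, hp.apply_apply, hf.1], by rw [hp.apply_apply, s_h]⟩).elim

end Local

end DartSystem

section EqvGen

open Relation

variable {α : Type*} {R : α → α → Prop} {r : α → α} {a b : α}

theorem reflTransGen_or_reflTransGen_of_eqvGen (hR : Relator.RightUnique R)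
    (hL : Relator.LeftUnique R) (h : EqvGen R a b) :
    ReflTransGen R a b ∨ ReflTransGen R b a := by
  induction h with
  | rel _ _ h => exact .inl (.single h)
  | refl => exact .inl .refl
  | symm _ _ _ ih => exact ih.symm
  | trans _ _ _ _ _ hab hbc =>
    rcases hab with hab | hba <;> rcases hbc with hbc | hcb
    · exact .inl (hab.trans hbc)
    · simpa only [reflTransGen_swap] using
        ReflTransGen.total_of_right_unique (r := Function.swap R) (fun _ _ _ hx hy => hL hx hy)
          (reflTransGen_swap.2 hab) (reflTransGen_swap.2 hcb) |>.symm
    · exact ReflTransGen.total_of_right_unique hR hba hbc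
    · exact .inr (hcb.trans hba)

/-- Read backwards through `r`, such a chain follows the same deterministic path, so stripping off
both ends leads to a chain `[c]` with `r c = c` or `[c, r c]`. -/
theorem getLast?_ne_of_isChain (hR : Relator.RightUnique R) (hr : r.Involutive)
    (hRr : ∀ a b, R a b → R (r b) (r a)) (hne : ∀ a, r a ≠ a) (hnr : ∀ a, ¬ R a (r a))
    (l : List α) : l.IsChain R → ∀ a ∈ l.head?, r a ∉ l.getLast? := by
  induction l using List.bidirectionalRec with
  | nil => simp
  | singleton b => simpa using (hne b).symm
  | cons_append b l c ih =>
    simp only [List.isChain_cons, List.isChain_append, List.head?_cons, Option.mem_some_iff]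
    rintro ⟨hb, hl, -, hc⟩ _ rfl hlast
    obtain rfl : c = r b := by
      rw [← List.cons_append, List.getLast?_concat] at hlast
      exact Option.some.inj hlast
    cases l with
    | nil => exact hnr b (hb _ (by simp))
    | cons d l =>
      obtain ⟨d', hd'⟩ : ∃ d', d' ∈ (d :: l).getLast? :=
        ⟨_, List.getLast?_eq_getLast_of_ne_nil (by simp)⟩
      have hbd : R b (r d') := by simpa only [hr b] using hRr _ _ (hc d' hd' (r b) (by simp))
      obtain rfl := hR (hb d (by simp)) hbd
      exact ih hl (r d') (by simp) (by rwa [hr])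

theorem not_eqvGen_apply (hR : Relator.RightUnique R) (hr : r.Involutive)
    (hRr : ∀ a b, R a b → R (r b) (r a)) (hne : ∀ a, r a ≠ a) (hnr : ∀ a, ¬ R a (r a)) (a : α) :
    ¬ EqvGen R a (r a) := by
  have hL : Relator.LeftUnique R := fun _ _ _ hac hbc =>
    hr.injective (hR (hRr _ _ hac) (hRr _ _ hbc))
  have hnot : ∀ a, ¬ ReflTransGen R a (r a) := fun a h => by
    obtain ⟨l, hl, hlast⟩ := List.exists_isChain_cons_of_relationReflTransGen h
    exact getLast?_ne_of_isChain hR hr hRr hne hnr _ hl a rfl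
      (by rw [← hlast]; exact List.getLast?_eq_getLast_of_ne_nil _)
  intro h
  rcases reflTransGen_or_reflTransGen_of_eqvGen hR hL h with h | h
  · exact hnot a h
  · exact hnot (r a) (by rwa [hr])

theorem not_eqvGen_apply_of_setoid (E : Setoid α)
    (hR : ∀ a a' b b', R a b → R a' b' → E a a' → E b b') (hr : r.Involutive)
    (hRr : ∀ a b, R a b → R (r b) (r a)) (hEr : ∀ a b, E a b → E (r a) (r b))
    (hne : ∀ a, ¬ E (r a) a) (hnr : ∀ a b, R a b → ¬ E b (r a)) (a : α) :
    ¬ EqvGen (fun a b => R a b ∨ E a b) a (r a) := by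
  let mk : α → Quotient E := Quotient.mk E
  have map_gen : ∀ a b, EqvGen (fun a b => R a b ∨ E a b) a b →
      EqvGen (Relation.Map R mk mk) (mk a) (mk b) := by
    intro a b h
    induction h with
    | rel a b h =>
      rcases h with hab | hab
      · exact .rel _ _ ⟨a, b, hab, rfl, rfl⟩
      · rw [show mk a = mk b from Quotient.sound hab]
        exact .refl _
    | refl => exact .refl _
    | symm _ _ _ ih => exact .symm _ _ ih
    | trans _ _ _ _ _ hab hbc => exact .trans _ _ _ hab hbc
  refine fun h => not_eqvGen_apply (r := Quotient.map r hEr) ?_ ?_ ?_ ?_ ?_ (mk a) (map_gen _ _ h)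
  · rintro _ _ _ ⟨a, b, hab, rfl, rfl⟩ ⟨a', b', hab', ha, rfl⟩
    exact Quotient.sound (hR _ _ _ _ hab hab' (E.symm (Quotient.exact ha)))
  · rintro ⟨a⟩
    exact congrArg mk (hr a)
  · rintro _ _ ⟨a, b, hab, rfl, rfl⟩
    exact ⟨_, _, hRr _ _ hab, rfl, rfl⟩
  · rintro ⟨a⟩ ha
    exact hne a (Quotient.exact ha)
  · rintro ⟨a⟩ ⟨b, c, hbc, hb, hc⟩
    exact hnr b c hbc (E.trans (Quotient.exact hc) (hEr _ _ (E.symm (Quotient.exact hb))))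

end EqvGen

namespace DartSystem

section Flips

variable {D V : Type*} {S : DartSystem D V} {p : D → D} {e f f' g h : D}

/-- A hexagon on which `p` acts as the rotation by a half turn; only three consecutive sides are
recorded, the other three being their images. -/
def Hex (S : DartSystem D V) (p : D → D) (e f g : D) : Prop :=
  S.To e f ∧ S.To f g ∧ S.To g (p e) ∧ S.To (p e) (p f) ∧ S.To (p f) (p g) ∧ S.To (p g) e

theorem Hex.of_op (hp : IsReversal S.Adj p) (hx : S.op.Hex p e f g) : S.Hex p e (p g) (p f) := by
  simp only [Hex, op_to, hp.apply_apply] at *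
  tauto

theorem op_not_hex (hp : IsReversal S.Adj p) (hn : ∀ e f g, ¬ S.Hex p e f g) :
    ∀ e f g, ¬ S.op.Hex p e f g := fun _ _ _ hx =>
  hn _ _ _ (hx.of_op hp)

/-- The paths `e, f` and `p f, p e` have the same end vertices. -/
structure Parallelogram (S : DartSystem D V) (p : D → D) (e f : D) : Prop where
  out : S.To e f
  s_f : S.s (p f) = S.s e
  s_e : S.s (p e) = S.t (p f)
  t_e : S.t (p e) = S.t f

namespace Parallelogram

theorem t_ne (hq : S.Parallelogram p e f) (hp : IsReversal S.Adj p) : S.t (p f) ≠ S.t e := by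
  have he := hp.not_adj_self e
  have := hq.out
  have := hq.s_e
  have := hq.t_e
  simp only [Adj, To] at *
  grind

theorem r_apply_to (hq : S.Parallelogram p e f) (hp : IsReversal S.Adj p) :
    S.To (S.r (p f)) e :=
  ⟨by rw [S.t_r, hq.s_f], by rw [S.s_r]; exact hq.t_ne hp⟩

theorem apply_to_r (hq : S.Parallelogram p e f) (hp : IsReversal S.Adj p) :
    S.To (p e) (S.r f) :=
  ⟨by rw [S.s_r, hq.t_e], by rw [S.t_r, hq.s_e, ← hq.out.1]; exact hq.t_ne hp⟩

end Parallelogram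

theorem path_hex_or (hp : IsReversal S.Adj p) (hne : ∀ e, p e ≠ S.r e) (hf : S.To e f)
    (hh : S.To h e) (hside : S.Adj f (p h)) :
    S.Hex p e f (p h) ∨ S.To (p f) (p e) ∧ S.To (p e) (p h) ∧
      (S.Parallelogram p e f ∨ S.op.Parallelogram p e h) := by
  have hef := (hp.adj_iff e f).2 (.inl hf)
  have heh := (hp.adj_iff e h).2 (.inr hh)
  rcases path_ends hp hne hf hh hside with ⟨h₁, h₂, h₃, h₄⟩ | ⟨t_h, t_f, s_e, t_e⟩ |
    ⟨s_h, s_f, s_e, t_e⟩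
  · left
    have hside' := hp.adj_swap hside
    simp only [Hex, hp.apply_apply]
    simp only [Adj, To] at *
    grind
  · refine .inr ⟨?_, ?_, .inr ⟨op_to.2 hh, t_h, t_e, s_e⟩⟩ <;>
      simp only [Adj, To] at * <;> grind
  · refine .inr ⟨?_, ?_, .inl ⟨hf, s_f, s_e, t_e⟩⟩ <;> simp only [Adj, To] at * <;> grind

/-- `p` reverses the orientation of the adjacency of `e` and `f`. -/
def Flips (S : DartSystem D V) (p : D → D) (e f : D) : Prop := S.To e f ↔ S.To (p f) (p e)

theorem flips_op (hp : IsReversal S.Adj p) (hef : S.Adj e f) :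
    S.op.Flips p e f ↔ S.Flips p e f := by
  unfold Flips
  rw [op_to, op_to, ← hef.not_to_iff, ← ((hp.adj_iff _ _).2 hef).symm.not_to_iff]
  tauto

theorem flips_comm (hp : IsReversal S.Adj p) (hef : S.Adj e f) :
    S.Flips p e f ↔ S.Flips p f e := by
  unfold Flips
  rw [← hef.not_to_iff, ← ((hp.adj_iff _ _).2 hef).symm.not_to_iff]
  tauto

theorem Flips.op_of_forall (hp : IsReversal S.Adj p) (hF : ∀ e f, S.Adj e f → S.Flips p e f) :
    ∀ e f, S.op.Adj e f → S.op.Flips p e f := fun e f hef =>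
  (flips_op hp (by rwa [op_adj] at hef)).2 (hF e f (by rwa [op_adj] at hef))

theorem Flips.of_to_of_to (hfe : S.To f e) (hef : S.To (p e) (p f)) : S.Flips p e f :=
  iff_of_false hfe.asymm hef.asymm

theorem fork_apply_to (hp : IsReversal S.Adj p) (hne : ∀ e, p e ≠ S.r e) (hf : S.To e f)
    (hg : S.To e g) (hfg : f ≠ g) (hside : S.Adj f (p g)) : S.To (p f) (p e) := by
  have hef := (hp.adj_iff e f).2 (.inl hf)
  have := fork_ends hp hne hf hg hfg hside
  simp only [Adj, To] at *
  grind

theorem fork_adj_apply_r (hp : IsReversal S.Adj p) (hf : S.To e f) (hf' : S.To e f')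
    (hside : S.Adj f (p f')) (hg : S.To e g) (hgf : f ≠ g) (hgf' : f' ≠ g) :
    S.Adj e (p (S.r g)) := by
  have hrg : S.To (S.r g) f := (adj_r_of_to_to hf hg hgf).symm.resolve_right fun hfg =>
    hgf (S.ext f g (hf.1.symm.trans hg.1) (by rw [hfg.1, S.s_r]))
  have hside' : S.Adj (p f') (p (S.r g)) := by
    rw [hp.adj_iff]
    exact adj_r_of_to_to hf' hg hgf'
  exact hp.side_trans f e (p f') (S.r g) (.inr hf) hside (.inr hrg)
    (fun heq => not_adj_r g (.inr (heq ▸ hg))) (by rw [hp.apply_apply]; exact .inl hf') hside'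

theorem fork_to_apply_r (hp : IsReversal S.Adj p) (hne : ∀ e, p e ≠ S.r e) (hf : S.To e f)
    (hf' : S.To e f') (hff : f ≠ f') (hside : S.Adj f (p f')) (hg : S.To e g)
    (hgf : f ≠ g) (hgf' : f' ≠ g) :
    S.To (p (S.r g)) e ∧ S.To (S.r (p (S.r g))) (p e) ∧ S.Adj f (S.r g) := by
  have hrg : S.Adj f (S.r g) := adj_r_of_to_to hf hg hgf
  have to_r_g : S.To (S.r g) f := hrg.symm.resolve_right fun hfg =>
    hgf (S.ext f g (hf.1.symm.trans hg.1) (by rw [hfg.1, S.s_r]))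
  have ends := fork_ends (S := S.op) (isReversal_op hp) hne (op_to.2 hf) (op_to.2 to_r_g)
    (fun heq => not_adj_r g (.inr (heq ▸ hg)))
    (by rw [op_adj]; exact fork_adj_apply_r hp hf hf' hside hg hgf hgf')
  have ends' := fork_ends hp hne hf hf' hff hside
  simp only [op, Adj, To, S.s_r, S.t_r] at *
  grind

section NoHex

variable (hp : IsReversal S.Adj p) (hne : ∀ e, p e ≠ S.r e) (hn : ∀ e f g, ¬ S.Hex p e f g)
include hp hne hn

theorem path_apply_to (hf : S.To e f) (hh : S.To h e) (hside : S.Adj f (p h)) :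
    S.To (p f) (p e) ∧ S.To (p e) (p h) :=
  ((path_hex_or hp hne hf hh hside).resolve_left (hn _ _ _)).imp_right And.left

theorem path_parallelogram (hf : S.To e f) (hh : S.To h e) (hside : S.Adj f (p h)) :
    S.Parallelogram p e f ∨ S.op.Parallelogram p e h :=
  ((path_hex_or hp hne hf hh hside).resolve_left (hn _ _ _)).2.2

theorem adj_r_apply_of_path (hf : S.To e f) (hh : S.To h e) (hside : S.Adj f (p h)) :
    S.Adj e (S.r (p f)) ∨ S.Adj e (S.r (p h)) :=
  (path_parallelogram hp hne hn hf hh hside).imp (fun hq => .inr (hq.r_apply_to hp))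
    (fun hq => .inl (op_to.1 (hq.r_apply_to (isReversal_op hp))))

theorem flips_of_side (hf : S.Adj e f) (hg : S.Adj e g) (hfg : f ≠ g)
    (hside : S.Adj f (p g)) : S.Flips p e f := by
  rcases hf with hf | hf <;> rcases hg with hg | hg
  · exact iff_of_true hf (fork_apply_to hp hne hf hg hfg hside)
  · exact iff_of_true hf (path_apply_to hp hne hn hf hg hside).1
  · exact .of_to_of_to hf (path_apply_to hp hne hn hg hf (hp.adj_swap hside)).2
  · exact .of_to_of_to hf (op_to.1 (fork_apply_to (isReversal_op hp) hne (op_to.2 hf)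
      (op_to.2 hg) hfg (by rwa [op_adj])))

theorem flips_of_fork_of_to (hf : S.To e f) (hf' : S.To e f') (hff : f ≠ f')
    (hside : S.Adj f (p f')) (hg : S.To e g) : S.Flips p e g := by
  by_cases hgf : f = g
  · exact hgf ▸ flips_of_side hp hne hn (.inl hf) (.inl hf') hff hside
  by_cases hgs : S.Adj f (p g)
  · exact flips_of_side hp hne hn (.inl hg) (.inl hf) (Ne.symm hgf) (hp.adj_swap hgs)
  obtain ⟨hk, hrk, hfg⟩ := fork_to_apply_r hp hne hf hf' hff hside hg hgf
    (fun heq => hgs (heq ▸ hside))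
  set k := p (S.r g) with hk_def
  have hfk : S.Adj k (p f) := by rw [hk_def, hp.adj_iff]; exact hfg.symm
  have hek : S.Adj e (p (S.r k)) := by rw [← hp.adj_left_iff]; exact .inr hrk
  have hfrk : ¬ S.Adj f (S.r k) := fun hadj => not_adj_r k (by
    have := hp.side_trans e k f (p (S.r k)) (.inr hk) (.inl hf) hek
      (fun heq => hne (S.r k) (by rw [r_r]; exact heq.symm)) hfk (by rwa [hp.apply_apply])
    rwa [hp.apply_apply] at this)
  by_cases hgk : p (S.r k) = g
  · refine iff_of_true hg ?_
    rwa [← hgk, hp.apply_apply]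
  refine flips_of_side hp hne hn (.inl hg) hek (Ne.symm hgk) ?_
  have hfk' : f ≠ p (S.r k) := fun heq => not_adj_r k (by
    rwa [heq, hp.apply_apply] at hfk)
  rcases hp.side_pigeonhole e f g (p (S.r k)) (.inl hf) (.inl hg) hek hgf (Ne.symm hgk) hfk'
    with h | h | h
  · exact absurd h hgs
  · exact h
  · exact absurd (by rwa [hp.apply_apply] at h) hfrk

theorem flips_of_fork (hf : S.To e f) (hf' : S.To e f') (hff : f ≠ f')
    (hside : S.Adj f (p f')) (hg : S.Adj e g) : S.Flips p e g := by
  rcases hg with hg | hg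
  · exact flips_of_fork_of_to hp hne hn hf hf' hff hside hg
  refine iff_of_false hg.asymm fun hpg => hpg.asymm ?_
  have flips_apply := flips_of_fork_of_to (isReversal_op hp) hne (op_not_hex hp hn)
    (op_to.2 (fork_apply_to hp hne hf hf' hff hside))
    (op_to.2 (fork_apply_to hp hne hf' hf hff.symm (hp.adj_swap hside)))
    (hp.injective.ne hff) (by rw [op_adj, hp.adj_iff]; exact hside) (op_to.2 hpg)
  rw [flips_op hp (.inr hpg)] at flips_apply
  unfold Flips at flips_apply
  rw [hp.apply_apply, hp.apply_apply] at flips_apply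
  exact flips_apply.2 hg

theorem flips_of_parallelogram (hq : S.Parallelogram p e f) (hg : S.Adj e g)
    (hgf : ¬ S.Adj g (p f)) (hfg : f ≠ g) : S.Flips p e g := by
  have hk := hq.r_apply_to hp
  have hl := hq.apply_to_r hp
  by_cases hgk : g = S.r (p f)
  · have hel : S.Adj e (p (S.r f)) := by rw [← hp.adj_left_iff]; exact .inl hl
    by_cases hgl : p (S.r f) = g
    · exact .of_to_of_to (hgk ▸ hk) (by rwa [← hgl, hp.apply_apply])
    · refine flips_of_side hp hne hn hg hel (Ne.symm hgl) ?_
      rcases hp.side_pigeonhole e f g (p (S.r f)) (.inl hq.out) hg hel hfg (Ne.symm hgl)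
        (fun heq => hne f (by conv_lhs => rw [heq, hp.apply_apply])) with h | h | h
      · exact absurd (hp.adj_swap h) hgf
      · exact h
      · exact absurd (by rwa [hp.apply_apply] at h) (not_adj_r f)
  · refine flips_of_side hp hne hn hg (.inr hk) hgk ?_
    rcases hp.side_pigeonhole e f g _ (.inl hq.out) hg (.inr hk) hfg hgk
      (fun heq => hne f (r_eq_iff.1 heq.symm)) with h | h | h
    · exact absurd (hp.adj_swap h) hgf
    · exact h
    · exact absurd (hp.adj_swap h) (fun hadj => not_adj_r _ hadj.symm)

theorem flips_of_path (hf : S.To e f) (hh : S.To h e) (hside : S.Adj f (p h))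
    (hg : S.Adj e g) : S.Flips p e g := by
  have hfh : f ≠ h := fun heq => hh.asymm (heq ▸ hf)
  by_cases hfg : f = g
  · exact hfg ▸ flips_of_side hp hne hn (.inl hf) (.inr hh) hfh hside
  by_cases hhg : h = g
  · exact hhg ▸ flips_of_side hp hne hn (.inr hh) (.inl hf) hfh.symm (hp.adj_swap hside)
  by_cases hgf : S.Adj g (p f)
  · exact flips_of_side hp hne hn hg (.inl hf) (Ne.symm hfg) hgf
  by_cases hgh : S.Adj g (p h)
  · exact flips_of_side hp hne hn hg (.inr hh) (Ne.symm hhg) hgh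
  rcases path_parallelogram hp hne hn hf hh hside with hq | hq
  · exact flips_of_parallelogram hp hne hn hq hg hgf hfg
  · rw [← flips_op hp hg]
    exact flips_of_parallelogram (isReversal_op hp) hne (op_not_hex hp hn) hq (by rwa [op_adj])
      (by rwa [op_adj]) hhg

theorem flips_of_exists_side (hf : S.Adj e f) (hf' : S.Adj e f') (hff : f ≠ f')
    (hside : S.Adj f (p f')) (hg : S.Adj e g) : S.Flips p e g := by
  rcases hf with hf | hf <;> rcases hf' with hf' | hf'
  · exact flips_of_fork hp hne hn hf hf' hff hside hg
  · exact flips_of_path hp hne hn hf hf' hside hg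
  · exact flips_of_path hp hne hn hf' hf (hp.adj_swap hside) hg
  · rw [← flips_op hp hg]
    exact flips_of_fork (isReversal_op hp) hne (op_not_hex hp hn) (op_to.2 hf) (op_to.2 hf') hff
      (by rwa [op_adj]) (by rwa [op_adj])

/-- If `e` has neighbours `a ≠ b` on the same side, `flips_of_exists_side` applies. Otherwise `e`
has at most the two neighbours `f` and `g`, one at each end, and so has `p e`. -/
theorem Flips.of_adj
    (third : ∀ e f g, S.Adj e f → S.Adj e g → f ≠ g → ¬ S.Adj f (p g) → (S.To e f ↔ S.To e g) →
      ∃ h, S.Adj e h ∧ h ≠ f ∧ h ≠ g)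
    (hf : S.Adj e f) (hg : S.Adj e g) (hef : S.Flips p e f) : S.Flips p e g := by
  by_cases hfg : f = g
  · rwa [← hfg]
  by_cases exists_side : ∃ a b, S.Adj e a ∧ S.Adj e b ∧ a ≠ b ∧ S.Adj a (p b)
  · obtain ⟨a, b, ha, hb, hab, hside⟩ := exists_side
    exact flips_of_exists_side hp hne hn ha hb hab hside hg
  push Not at exists_side
  have eq_or_eq : ∀ k, S.Adj e k → k = f ∨ k = g := fun k hk => by
    by_contra! hne'
    rcases hp.side_pigeonhole e f g k hf hg hk hfg hne'.2.symm hne'.1.symm with h | h | h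
    · exact exists_side _ _ hf hg hfg h
    · exact exists_side _ _ hg hk hne'.2.symm h
    · exact exists_side _ _ hf hk hne'.1.symm h
  have ends_e : ¬ (S.To e f ↔ S.To e g) := fun same => by
    obtain ⟨k, hk, hkf, hkg⟩ := third e f g hf hg hfg (exists_side _ _ hf hg hfg) same
    exact (eq_or_eq k hk).elim hkf hkg
  have ends_apply : ¬ (S.To (p e) (p f) ↔ S.To (p e) (p g)) := fun same => by
    obtain ⟨k, hk, hkf, hkg⟩ := third (p e) (p f) (p g) ((hp.adj_iff _ _).2 hf)
      ((hp.adj_iff _ _).2 hg) (hp.injective.ne hfg)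
      (by rw [hp.adj_iff]; exact exists_side _ _ hf hg hfg) same
    rw [hp.adj_left_iff] at hk
    rcases eq_or_eq _ hk with heq | heq
    · exact hkf (by rw [← heq, hp.apply_apply])
    · exact hkg (by rw [← heq, hp.apply_apply])
  unfold Flips at *
  rw [← ((hp.adj_iff _ _).2 hf).not_to_iff] at hef
  rw [← ((hp.adj_iff _ _).2 hg).not_to_iff]
  tauto

end NoHex

theorem exists_path_side (hp : IsReversal S.Adj p) (hne : ∀ e, p e ≠ S.r e) (hf : S.Adj e f)
    (hg : S.Adj e g) (hfg : f ≠ g) (hside : S.Adj f (p g)) :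
    ∃ e f g, S.To e f ∧ S.To g e ∧ S.Adj f (p g) := by
  have to_apply : ∀ S : DartSystem D V, IsReversal S.Adj p → (∀ e, p e ≠ S.r e) → S.To e f →
      S.To e g → S.Adj f (p g) → S.To f (p g) := by
    intro S hp hne hf hg hside
    have := fork_ends hp hne hf hg hfg hside
    simp only [Adj, To] at *
    grind
  rcases hf with hf | hf <;> rcases hg with hg | hg
  · exact ⟨f, p g, e, to_apply S hp hne hf hg hside, hf, by rw [hp.adj_iff]; exact .inr hg⟩
  · exact ⟨e, f, g, hf, hg, hside⟩
  · exact ⟨e, g, f, hg, hf, hp.adj_swap hside⟩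
  · refine ⟨f, e, p g, hf, ?_, by rw [hp.apply_apply]; exact .inr hg⟩
    exact op_to.1 (to_apply S.op (isReversal_op hp) hne (op_to.2 hf) (op_to.2 hg)
      (by rwa [op_adj]))

theorem Parallelogram.commutes (hp : IsReversal S.Adj p)
    (hF : ∀ e f, S.Adj e f → S.Flips p e f) (hq : S.Parallelogram p e f) :
    p (S.r (p f)) = S.r (p (p f)) := by
  have hk := hq.r_apply_to hp
  rw [hp.apply_apply]
  by_contra hne
  have hadj := adj_r_of_to_to ((hF _ _ (.inl hk)).1 hk) (hq.apply_to_r hp) hne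
  rw [r_r, hp.adj_left_iff] at hadj
  exact not_adj_r _ hadj.symm

theorem exists_commutes (hp : IsReversal S.Adj p) (hne : ∀ e, p e ≠ S.r e)
    (hn : ∀ e f g, ¬ S.Hex p e f g) (hF : ∀ e f, S.Adj e f → S.Flips p e f) (hf : S.Adj e f)
    (hg : S.Adj e g) (hfg : f ≠ g) (hside : S.Adj f (p g)) : ∃ x, p (S.r x) = S.r (p x) := by
  obtain ⟨e, f, h, hf, hh, hside⟩ := exists_path_side hp hne hf hg hfg hside
  rcases path_parallelogram hp hne hn hf hh hside with hq | hq
  · exact ⟨_, hq.commutes hp hF⟩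
  · exact ⟨_, Parallelogram.commutes (S := S.op) (isReversal_op hp) (Flips.op_of_forall hp hF) hq⟩

theorem commutes_of_to (hp : IsReversal S.Adj p) (hF : ∀ e f, S.Adj e f → S.Flips p e f)
    (hef : S.To e f) (he : p (S.r e) = S.r (p e)) : p (S.r f) = S.r (p f) := by
  have to_apply := (hF _ _ (.inl hef)).1 hef
  have r_to_apply := (hF _ _ (.inl (to_r_r.2 hef))).1 (to_r_r.2 hef)
  rw [he] at r_to_apply
  by_contra hne
  have hadj := adj_r_of_to_to r_to_apply (to_r_r.2 to_apply) hne
  rw [r_r, hp.adj_iff] at hadj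
  exact not_adj_r _ hadj.symm

theorem commutes_of_linked (hp : IsReversal S.Adj p) (hC : Linked S.Adj)
    (hF : ∀ e f, S.Adj e f → S.Flips p e f) (he : p (S.r e) = S.r (p e)) (f : D) :
    p (S.r f) = S.r (p f) := by
  refine hC.induction (P := fun e => p (S.r e) = S.r (p e)) he (fun e f hef he => ?_) f
  rcases hef with hef | hfe
  · exact commutes_of_to hp hF hef he
  · exact commutes_of_to (S := S.op) (isReversal_op hp) (Flips.op_of_forall hp hF) (op_to.2 hfe) he

end Flips

end DartSystem

theorem Linked.eqvGen {D : Type*} {R A : D → D → Prop} (h : Linked A)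
    (hA : ∀ e f, A e f → R e f ∨ R f e) (e f : D) : Relation.EqvGen R e f :=
  h.induction (P := Relation.EqvGen R e) (.refl e) (fun _ _ hab he => he.trans _ _ _
    ((hA _ _ hab).elim (.rel _ _) fun hba => .symm _ _ (.rel _ _ hba))) f

namespace DartSystem

section NoHex

variable {D V W : Type*} {S : DartSystem D V} {T : DartSystem D W} {p : D → D} {σ : V → V}
  {e f g : D}

theorem exists_side_of_linked [Nonempty D] (hA : ∀ e f, S.Adj e f ↔ T.Adj e f)
    (hC : Linked S.Adj) : ∃ e f g, S.Adj e f ∧ S.Adj e g ∧ f ≠ g ∧ S.Adj f (T.r g) := by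
  by_contra! hn
  have e : D := Classical.arbitrary D
  refine not_eqvGen_apply (R := T.To) (fun e f g hf hg => ?_) T.r_r (fun e f => T.to_r_r.2)
    T.r_ne (fun e h => T.not_adj_r e (.inl h)) e (hC.eqvGen (fun e f h => (hA e f).1 h) _ _)
  by_contra hfg
  exact hn e f g ((hA _ _).2 (.inl hf)) ((hA _ _).2 (.inl hg)) hfg
    ((hA _ _).2 (T.adj_r_of_to_to hf hg hfg))

/-- In `T`, the darts `f` and `g` lie at different ends of `e`, but on the same side with respect
to `S.r`, so `adj_r_apply_of_path` applies. -/
theorem adj_apply_r_or (hA : ∀ e f, S.Adj e f ↔ T.Adj e f) (hne : ∀ e, S.r e ≠ T.r e)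
    (hn : ∀ e f g, ¬ T.Hex S.r e f g) (hf : S.Adj e f) (hg : S.Adj e g) (hfg : f ≠ g)
    (hT : ¬ S.Adj f (T.r g)) (hS : S.To e f ↔ S.To e g) :
    S.Adj e (T.r (S.r f)) ∨ S.Adj e (T.r (S.r g)) := by
  have hp : IsReversal T.Adj S.r := isReversal_of_adj_iff fun e f => (hA e f).symm
  have hfg' := (adj_r_iff hf hg hfg).2 hS
  rw [hA] at hf hg hfg' hT
  rw [T.adj_r_iff hf hg hfg] at hT
  simp only [hA]
  rcases hf with hf | hf <;> rcases hg with hg | hg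
  · exact absurd (iff_of_true hf hg) hT
  · exact adj_r_apply_of_path hp hne hn hf hg hfg'
  · exact (adj_r_apply_of_path hp hne hn hg hf (hp.adj_swap hfg')).symm
  · exact absurd (iff_of_false hf.asymm hg.asymm) hT

theorem exists_third_adj (hA : ∀ e f, S.Adj e f ↔ T.Adj e f) (hne : ∀ e, S.r e ≠ T.r e)
    (hn : ∀ e f g, ¬ T.Hex S.r e f g) (hf : S.Adj e f) (hg : S.Adj e g) (hfg : f ≠ g)
    (hT : ¬ S.Adj f (T.r g)) (hS : S.To e f ↔ S.To e g) :
    ∃ h, S.Adj e h ∧ h ≠ f ∧ h ≠ g := by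
  have apply_ne : ∀ a b, S.Adj b (S.r a) → T.r (S.r a) ≠ b := fun a b hab heq =>
    T.not_adj_r _ ((hA _ _).1 (heq ▸ hab)).symm
  rcases adj_apply_r_or hA hne hn hf hg hfg hT hS with h | h
  · exact ⟨_, h, fun heq => hne f (T.r_eq_iff.1 heq),
      apply_ne _ _ ((adj_r_iff hg hf hfg.symm).2 hS.symm)⟩
  · exact ⟨_, h, apply_ne _ _ ((adj_r_iff hf hg hfg).2 hS), fun heq => hne g (T.r_eq_iff.1 heq)⟩

theorem flips_and_commutes [Nonempty D] (hA : ∀ e f, S.Adj e f ↔ T.Adj e f)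
    (hC : Linked S.Adj) (hne : ∀ e, T.r e ≠ S.r e) (hn : ∀ e f g, ¬ S.Hex T.r e f g)
    (hn' : ∀ e f g, ¬ T.Hex S.r e f g) :
    (∀ e f, S.Adj e f → S.Flips T.r e f) ∧ ∀ e, T.r (S.r e) = S.r (T.r e) := by
  have hp := isReversal_of_adj_iff hA
  obtain ⟨e, f, g, hf, hg, hfg, hside⟩ := exists_side_of_linked hA hC
  have hF : ∀ e f, S.Adj e f → S.Flips T.r e f := by
    refine hC.induction (fun _ => flips_of_exists_side hp hne hn hf hg hfg hside)
      fun a b hab ha c hbc => ?_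
    exact Flips.of_adj hp hne hn (fun _ _ _ => exists_third_adj hA (fun e => (hne e).symm) hn')
      hab.symm hbc ((flips_comm hp hab).1 (ha b hab))
  obtain ⟨x, hx⟩ := exists_commutes hp hne hn hF hf hg hfg hside
  exact ⟨hF, commutes_of_linked hp hC hF hx⟩

/-- `σ` is the action on the vertices of the automorphism `r ∘ p` of the dart system. -/
structure IsVertexMap (S : DartSystem D V) (p : D → D) (σ : V → V) : Prop where
  involutive : σ.Involutive
  apply_s : ∀ e, σ (S.s e) = S.t (p e)
  apply_t : ∀ e, σ (S.t e) = S.s (p e)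

theorem exists_isVertexMap (hs : S.s.Surjective) (hp : IsReversal S.Adj p)
    (hF : ∀ e f, S.Adj e f → S.Flips p e f) (hcomm : ∀ e, p (S.r e) = S.r (p e)) :
    ∃ σ, S.IsVertexMap p σ := by
  have t_apply_eq : ∀ e f, S.s e = S.s f → S.t (p e) = S.t (p f) := fun e f hef => by
    rcases s_eq_iff.1 hef with rfl | hef
    · rfl
    · rw [((hF _ _ (.inl hef)).1 hef).1, hcomm, S.s_r]
  choose dart hdart using hs
  have apply_s : ∀ e, S.t (p (dart (S.s e))) = S.t (p e) := fun e => t_apply_eq _ _ (hdart _)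
  have apply_t : ∀ e, S.t (p (dart (S.t e))) = S.s (p e) := fun e => by
    simpa only [S.s_r, hcomm, S.t_r] using apply_s (S.r e)
  exact ⟨fun v => S.t (p (dart v)), fun v => by rw [apply_t, hp.apply_apply, hdart],
    apply_s, apply_t⟩

namespace IsVertexMap

theorem apply_s_ne_s (hσ : S.IsVertexMap p σ) (hp : IsReversal S.Adj p) (hne : ∀ e, p e ≠ S.r e)
    (e : D) : σ (S.s e) ≠ S.s e := fun heq => by
  rw [hσ.apply_s] at heq
  have := hp.not_adj_self e
  have := S.ext (p e) (S.r e)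
  simp only [Adj, To, S.s_r, S.t_r] at *
  grind

theorem apply_s_ne_t (hσ : S.IsVertexMap p σ) (hp : IsReversal S.Adj p) (e : D) :
    σ (S.s e) ≠ S.t e := fun heq =>
  hp.ne_self e (S.ext _ _ (by rw [← hσ.apply_t, ← heq, hσ.involutive]) (by rw [← hσ.apply_s, heq]))

/-- Two darts are equivalent if their end vertices agree up to `σ`, at either end separately. -/
def setoid (hσ : S.IsVertexMap p σ) : Setoid D where
  r e f := (S.s e = S.s f ∨ S.s e = σ (S.s f)) ∧ (S.t e = S.t f ∨ S.t e = σ (S.t f))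
  iseqv := by
    have := hσ.involutive
    exact ⟨fun e => ⟨.inl rfl, .inl rfl⟩, by grind [Function.Involutive],
      by grind [Function.Involutive]⟩

theorem setoid_iff (hσ : S.IsVertexMap p σ) : hσ.setoid e f ↔
    (S.s e = S.s f ∨ S.s e = σ (S.s f)) ∧ (S.t e = S.t f ∨ S.t e = σ (S.t f)) :=
  Iff.rfl

theorem s_r_apply (hσ : S.IsVertexMap p σ) (e : D) : S.s (S.r (p e)) = σ (S.s e) := by
  rw [S.s_r, hσ.apply_s]

theorem t_r_apply (hσ : S.IsVertexMap p σ) (e : D) : S.t (S.r (p e)) = σ (S.t e) := by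
  rw [S.t_r, hσ.apply_t]

theorem setoid_r_apply (hσ : S.IsVertexMap p σ) (e : D) : hσ.setoid (S.r (p e)) e :=
  ⟨.inr (hσ.s_r_apply e), .inr (hσ.t_r_apply e)⟩

theorem setoid_r (hσ : S.IsVertexMap p σ) (hef : hσ.setoid e f) :
    hσ.setoid (S.r e) (S.r f) := by
  simpa only [setoid_iff, S.s_r, S.t_r] using hef.symm

theorem not_setoid_r (hσ : S.IsVertexMap p σ) (hp : IsReversal S.Adj p) (e : D) :
    ¬ hσ.setoid (S.r e) e := fun h => by
  rw [setoid_iff, S.s_r, S.t_r] at h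
  have := hσ.apply_s_ne_t hp e
  have := S.s_ne_t e
  grind

end IsVertexMap

/-- The path `e, f` does not return to its starting vertex, not even up to `σ`. -/
def Advances (S : DartSystem D V) (σ : V → V) (e f : D) : Prop :=
  S.t e = S.s f ∧ S.t f ≠ S.s e ∧ S.t f ≠ σ (S.s e)

namespace IsVertexMap

theorem advances_r (hσ : S.IsVertexMap p σ) (hef : S.Advances σ e f) :
    S.Advances σ (S.r f) (S.r e) := by
  have := hσ.involutive (S.t f)
  simp only [Advances, S.s_r, S.t_r] at *
  grind

theorem advances_r_apply (hσ : S.IsVertexMap p σ) (hef : S.Advances σ e f) :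
    S.Advances σ (S.r (p e)) (S.r (p f)) := by
  have := hσ.involutive (S.t f)
  have := hσ.involutive (S.s e)
  simp only [Advances, hσ.s_r_apply, hσ.t_r_apply] at *
  grind

theorem not_adj_apply_r (hσ : S.IsVertexMap p σ) (hp : IsReversal S.Adj p)
    (hne : ∀ e, p e ≠ S.r e) (hcomm : ∀ e, p (S.r e) = S.r (p e)) (hef : S.Advances σ e f) :
    ¬ S.Adj e (p (S.r f)) := by
  have s_f := hσ.s_r_apply f
  have t_f := hσ.t_r_apply f
  have := hσ.apply_s_ne_s hp hne f
  have := hσ.involutive (S.t f)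
  simp only [← hcomm, Advances, Adj, To] at *
  grind

/-- Either `f` and `g` are exchanged by `r ∘ p` up to one of their ends, by `fork_ends`, or
`hspare` yields an adjacency that `not_adj_apply_r` excludes. -/
theorem setoid_of_advances_of_advances (hσ : S.IsVertexMap p σ) (hp : IsReversal S.Adj p)
    (hne : ∀ e, p e ≠ S.r e) (hcomm : ∀ e, p (S.r e) = S.r (p e))
    (hspare : ∀ e f g, S.Adj e f → S.Adj e g → f ≠ g → ¬ S.Adj f (p g) → (S.To e f ↔ S.To e g) →
      S.Adj e (p (S.r f)) ∨ S.Adj e (p (S.r g)))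
    (hf : S.Advances σ e f) (hg : S.Advances σ e g) : hσ.setoid f g := by
  refine ⟨.inl (hf.1.symm.trans hg.1), ?_⟩
  by_cases hfg : f = g
  · exact .inl (by rw [hfg])
  have to_f : S.To e f := ⟨hf.1, hf.2.1.symm⟩
  have to_g : S.To e g := ⟨hg.1, hg.2.1.symm⟩
  by_cases hside : S.Adj f (p g)
  · have := (fork_ends hp hne to_f to_g hfg hside).2.1
    rw [← hσ.apply_t] at this
    exact .inr this.symm
  · rcases hspare e f g (.inl to_f) (.inl to_g) hfg hside (iff_of_true to_f to_g) with h | h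
    · exact (hσ.not_adj_apply_r hp hne hcomm hf h).elim
    · exact (hσ.not_adj_apply_r hp hne hcomm hg h).elim

theorem setoid_of_advances (hσ : S.IsVertexMap p σ)
    (hsetoid : ∀ e f g, S.Advances σ e f → S.Advances σ e g → hσ.setoid f g)
    {e e' f g : D} (hf : S.Advances σ e f) (hg : S.Advances σ e' g) (hee : hσ.setoid e e') :
    hσ.setoid f g := by
  have of_t_eq {e' g} (hg : S.Advances σ e' g) (hee : hσ.setoid e e') (ht : S.t e = S.t e') :
      hσ.setoid f g := by
    refine hsetoid e f g hf ?_
    have := hσ.involutive (S.s e')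
    simp only [setoid_iff, Advances] at *
    grind
  rcases hee.2 with ht | ht
  · exact of_t_eq hg hee ht
  · have := of_t_eq (hσ.advances_r_apply hg)
      (hσ.setoid.trans hee (hσ.setoid.symm (hσ.setoid_r_apply _))) (by rw [ht, hσ.t_r_apply])
    exact hσ.setoid.trans this (hσ.setoid_r_apply g)

theorem not_eqvGen_r (hσ : S.IsVertexMap p σ) (hp : IsReversal S.Adj p)
    (hsetoid : ∀ e f g, S.Advances σ e f → S.Advances σ e g → hσ.setoid f g) (e : D) :
    ¬ Relation.EqvGen (fun e f => S.Advances σ e f ∨ hσ.setoid e f) e (S.r e) := by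
  refine not_eqvGen_apply_of_setoid hσ.setoid
    (fun _ _ _ _ => hσ.setoid_of_advances hsetoid) (fun _ => r_r _) (fun _ _ => hσ.advances_r)
    (fun _ _ => hσ.setoid_r) (hσ.not_setoid_r hp) (fun e f hef h => ?_) e
  rw [setoid_iff, S.s_r, S.t_r] at h
  exact h.2.elim hef.2.1 hef.2.2

theorem adj_r_apply_of_not_advances (hσ : S.IsVertexMap p σ) (hp : IsReversal S.Adj p)
    (hne : ∀ e, p e ≠ S.r e) (hef : S.Adj e f) (hnot : ¬ S.Advances σ e f)
    (hnot' : ¬ S.Advances σ f e) : S.Adj e (S.r (p f)) := by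
  have := hσ.apply_s_ne_s hp hne f
  have := hσ.apply_s_ne_s hp hne e
  have := hσ.involutive (S.s e)
  simp only [Advances, Adj, To, hσ.s_r_apply, hσ.t_r_apply] at *
  grind

end IsVertexMap

/-- The automorphism `S.r ∘ T.r` and the class `I` of a dart `e` under advancing and equivalence
give a twist of `T` that agrees with `S` on the reversal of `e`, because `r e` is not in `I`. -/
theorem graph_iso_of_no_hex [Nonempty D] (hs : S.s.Surjective) (ht : T.s.Surjective)
    (hA : ∀ e f, S.Adj e f ↔ T.Adj e f) (hC : Linked S.Adj) (hne : ∀ e, T.r e ≠ S.r e)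
    (hn : ∀ e f g, ¬ S.Hex T.r e f g) (hn' : ∀ e f g, ¬ T.Hex S.r e f g) :
    Nonempty (S.graph ≃g T.graph) := by
  have hp := isReversal_of_adj_iff hA
  obtain ⟨hF, hcomm⟩ := flips_and_commutes hA hC hne hn hn'
  obtain ⟨σ, hσ⟩ := exists_isVertexMap hs hp hF hcomm
  have hsetoid : ∀ e f g, S.Advances σ e f → S.Advances σ e g → hσ.setoid f g := fun _ _ _ =>
    hσ.setoid_of_advances_of_advances hp hne hcomm fun _ _ _ =>
      adj_apply_r_or hA (fun e => (hne e).symm) hn'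
  have e : D := Classical.arbitrary D
  let I : D → Prop := Relation.EqvGen (fun e f => S.Advances σ e f ∨ hσ.setoid e f) e
  have step {i u} (h : S.Advances σ i u ∨ hσ.setoid i u) : I i ↔ I u :=
    ⟨fun hi => hi.trans _ _ _ (.rel _ _ h), fun hu => hu.trans _ _ _ (.symm _ _ (.rel _ _ h))⟩
  have mem_apply : ∀ u, I (T.r (S.r u)) ↔ I u := fun u => by
    rw [hcomm]
    exact step (.inr (hσ.setoid_r_apply u))
  have cross : ∀ i u, I i → ¬ I u → S.Adj i u → S.Adj i (T.r (S.r u)) := fun i u hi hu hiu => by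
    rw [hcomm]
    exact hσ.adj_r_apply_of_not_advances hp hne hiu (fun h => hu ((step (.inl h)).1 hi))
      (fun h => hu ((step (.inl h)).2 hi))
  obtain ⟨θ, hAθ, hθ, hθ'⟩ := exists_twist hA I mem_apply fun i u hi hu =>
    ⟨cross i u hi hu, fun h => by
      have := cross i _ hi (by rwa [mem_apply]) h
      rwa [hcomm u, r_r, T.r_r] at this⟩
  rw [← T.comap_graph θ]
  refine graph_iso_of_common_reversal hs (ht.comp θ.surjective) hAθ hC (e := e) ?_
  have not_mem : ¬ I (S.r e) := hσ.not_eqvGen_r hp hsetoid e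
  simp only [comap, Equiv.symm_apply_eq, hθ _ (.refl _), hθ' _ not_mem, r_r]

end NoHex

section Braid

variable {D V W : Type*} {S : DartSystem D V} {T : DartSystem D W}

/-- Conjugating by `S.r ∘ T.r`, which preserves the adjacency, turns `T` into a dart system that
agrees with `S` on the reversal of `e`. -/
theorem graph_iso_of_braid (hs : S.s.Surjective) (ht : T.s.Surjective)
    (hA : ∀ e f, S.Adj e f ↔ T.Adj e f) (hC : Linked S.Adj) {e : D}
    (he : T.r (S.r (T.r (S.r (T.r e)))) = S.r e) : Nonempty (S.graph ≃g T.graph) := by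
  let θ : D ≃ D := T.rPerm.trans S.rPerm
  have hθ : ∀ e f, S.Adj e f ↔ (T.comap θ).Adj e f := fun e f => by
    rw [comap_adj, ← hA]
    exact (((isReversal_of_adj_iff hA).adj_iff e f).symm.trans adj_r_r.symm)
  rw [← T.comap_graph θ]
  exact graph_iso_of_common_reversal hs (ht.comp θ.surjective) hθ hC he

end Braid

section Hex

variable {D V : Type*} {S : DartSystem D V} {p : D → D} {e f g x y z : D}

namespace Hex

theorem rot (h : S.Hex p e f g) (hp : IsReversal S.Adj p) : S.Hex p f g (p e) := by
  simp only [Hex, hp.apply_apply] at *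
  tauto

theorem rot_rot (h : S.Hex p e f g) (hp : IsReversal S.Adj p) : S.Hex p g (p e) (p f) :=
  (h.rot hp).rot hp

theorem half (h : S.Hex p e f g) (hp : IsReversal S.Adj p) : S.Hex p (p e) (p f) (p g) :=
  (h.rot_rot hp).rot hp

theorem rot_neg (h : S.Hex p e f g) (hp : IsReversal S.Adj p) : S.Hex p (p g) e f := by
  simpa only [hp.apply_apply] using (h.half hp).rot_rot hp

theorem t_eq (h : S.Hex p e f g) : S.t e = S.s f ∧ S.t f = S.s g ∧ S.t g = S.s (p e) ∧
    S.t (p e) = S.s (p f) ∧ S.t (p f) = S.s (p g) ∧ S.t (p g) = S.s e :=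
  ⟨h.1.1, h.2.1.1, h.2.2.1.1, h.2.2.2.1.1, h.2.2.2.2.1.1, h.2.2.2.2.2.1⟩

theorem s_ne (h : S.Hex p e f g) (hp : IsReversal S.Adj p) :
    S.s e ≠ S.s f ∧ S.s e ≠ S.s g ∧ S.s e ≠ S.s (p e) := by
  have s_ne_t_e := S.s_ne_t e
  have s_ne_t_f := S.s_ne_t f
  have not_adj := hp.not_adj_of_adj g e
  simp only [Hex, Adj, To] at *
  grind

theorem nodup (h : S.Hex p e f g) (hp : IsReversal S.Adj p) :
    [S.s e, S.s f, S.s g, S.s (p e), S.s (p f), S.s (p g)].Nodup := by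
  have h₀ := h.s_ne hp
  have h₁ := (h.rot hp).s_ne hp
  have h₂ := (h.rot_rot hp).s_ne hp
  have h₃ := (h.half hp).s_ne hp
  have h₄ := ((h.half hp).rot hp).s_ne hp
  have h₅ := (h.rot_neg hp).s_ne hp
  simp only [hp.apply_apply] at *
  simp only [List.nodup_cons, List.mem_cons, List.not_mem_nil, or_false, not_or, not_false_eq_true,
    List.nodup_nil, and_true]
  grind

end Hex

/-- `x` leaves the walk `e, f` at the middle vertex. -/
def Spoke (S : DartSystem D V) (e f x : D) : Prop := S.To e x ∧ x ≠ f

theorem spoke_iff (hf : S.To e f) :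
    S.Spoke e f x ↔ S.s x = S.s f ∧ S.t x ≠ S.s e ∧ S.t x ≠ S.t f := by
  have ext := S.ext x f
  simp only [Spoke, To] at *
  grind

theorem Spoke.r_to (hx : S.Spoke e f x) (hf : S.To e f) : S.To (S.r x) f := by
  have hx' := (spoke_iff hf).1 hx
  exact ⟨by rw [S.t_r, hx'.1], by rw [S.s_r]; exact hx'.2.2⟩

theorem Spoke.to_r (hx : S.Spoke e f x) (hf : S.To e f) : S.To (S.r f) x := by
  rw [← S.r_r x, to_r_r]
  exact hx.r_to hf

namespace Hex

theorem spoke_or (h : S.Hex p e f g) (hy : S.Adj e y) (hf : y ≠ f) (hg : y ≠ p g) :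
    S.Spoke e f y ∨ S.Spoke (p g) e (S.r y) := by
  have ht := h.t_eq
  rcases hy with hy | hy
  · exact .inl ⟨hy, hf⟩
  · refine .inr ⟨?_, fun h' => not_adj_r y (.inl (h' ▸ hy))⟩
    have := S.ext y (p g)
    simp only [To, S.s_r, S.t_r] at *
    grind

theorem spoke_or_half (h : S.Hex p e f g) (hp : IsReversal S.Adj p) (hy : S.Adj e y)
    (hf : y ≠ f) (hg : y ≠ p g) : S.Spoke (p e) (p f) (p y) ∨ S.Spoke g (p e) (S.r (p y)) := by
  have := (h.half hp).spoke_or (y := p y) ((hp.adj_iff _ _).2 hy) (fun h => hf (hp.injective h))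
    (fun h => hg (hp.injective h))
  rwa [hp.apply_apply] at this

section

variable (h : S.Hex p e f g) (hp : IsReversal S.Adj p) (hne : ∀ e, p e ≠ S.r e)
include h hp hne

theorem spoke_t_ne (hx : S.Spoke e f x) : S.t x ≠ S.s (p f) := by
  intro hc
  have hn := h.nodup hp
  have ht := h.t_eq
  simp only [List.nodup_cons, List.mem_cons, List.not_mem_nil, or_false, not_or] at hn
  have hside : S.Adj f (p x) := by
    rw [← hp.adj_left_iff]
    obtain ⟨hx, -⟩ := hx
    simp only [Adj, To] at *
    grind
  have := fork_ends hp hne h.1 hx.1 hx.2.symm hside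
  grind

theorem spoke_end (hx : S.Spoke e f x) :
    S.t x ∉ [S.s e, S.s f, S.s g, S.s (p e), S.s (p f), S.s (p g)] := by
  have hc := h.spoke_t_ne hp hne hx
  have ht := h.t_eq
  have hx' := (spoke_iff h.1).1 hx
  have s_ne_t := S.s_ne_t x
  have not_adj_e := hp.not_adj_of_adj x e (.inr hx.1)
  have not_adj_f := hp.not_adj_of_adj (S.r x) f (.inl (hx.r_to h.1))
  have hn := h.nodup hp
  simp only [List.nodup_cons, List.mem_cons, List.not_mem_nil, or_false, not_or] at *
  simp only [Adj, To, S.s_r, S.t_r] at *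
  grind

theorem not_side (hx : S.Spoke e f x) : ¬ S.Adj f (p x) := by
  rw [← hp.adj_left_iff]
  have hc := h.spoke_t_ne hp hne hx
  have hn := h.nodup hp
  have ht := h.t_eq
  obtain ⟨hx, -⟩ := hx
  simp only [List.nodup_cons, List.mem_cons, List.not_mem_nil, or_false, not_or] at *
  simp only [Adj, To] at *
  grind

theorem spoke_unique (hx : S.Spoke e f x) (hy : S.Spoke e f y) : x = y := by
  by_contra hxy
  have hside : S.Adj x (p y) := by
    rcases hp.side_pigeonhole e f x y (.inl h.1) (.inl hx.1) (.inl hy.1) hx.2.symm hxy hy.2.symm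
      with h' | h' | h'
    · exact absurd h' (h.not_side hp hne hx)
    · exact h'
    · exact absurd h' (h.not_side hp hne hy)
  have hfy : S.Adj (S.r f) (p (p y)) := by rw [hp.apply_apply]; exact .inl (hy.to_r h.1)
  have hey : S.Adj e (p (p y)) := by rw [hp.apply_apply]; exact .inl hy.1
  have hef : e ≠ S.r f := fun h' => not_adj_r f (.inr (h' ▸ h.1))
  have hside' := hp.side_trans x e (p y) (S.r f) (.inr hx.1) hside (.inr (hx.to_r h.1)) hef hey
    (hp.adj_swap hfy)
  rw [← hp.adj_left_iff] at hside'
  have hn := h.nodup hp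
  have ht := h.t_eq
  simp only [List.nodup_cons, List.mem_cons, List.not_mem_nil, or_false, not_or] at *
  simp only [Adj, To, S.s_r, S.t_r] at *
  grind

/-- Adjacent spokes span another hexagon on which `p` is the half turn. -/
theorem of_spokes (hx : S.Spoke e f x) (hz : S.Spoke (p g) e z) :
    S.Hex p e x (p (S.r z)) := by
  have hn := h.nodup hp
  have ht := h.t_eq
  have t_ne_x := h.spoke_t_ne hp hne hx
  have t_ne_z := (h.rot_neg hp).spoke_t_ne hp hne hz
  have hze : S.To (S.r z) e := hz.r_to h.2.2.2.2.2
  have hxz : x ≠ S.r z := fun h => hze.asymm (h ▸ hx.1)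
  have hfz : f ≠ S.r z := fun h' => hze.asymm (h' ▸ h.1)
  have hz' := (spoke_iff h.2.2.2.2.2).1 hz
  simp only [List.nodup_cons, List.mem_cons, List.not_mem_nil, or_false, not_or] at hn
  have hside : S.Adj x (p (S.r z)) := by
    rcases hp.side_pigeonhole e f x (S.r z) (.inl h.1) (.inl hx.1) (.inr hze) hx.2.symm hxz hfz
      with h' | h' | h'
    · exact absurd h' (h.not_side hp hne hx)
    · exact h'
    · rw [← hp.adj_left_iff] at h'
      simp only [Adj, To, S.s_r, S.t_r] at *
      grind
  rcases path_hex_or hp hne hx.1 hze hside with h' | ⟨-, -, hq | hq⟩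
  · exact h'
  · have := hq.s_e
    have := hq.t_e
    grind
  · have := hq.t_e
    simp only [op, S.s_r] at this
    grind

end

end Hex

end Hex

section Hex

variable {D V : Type*} {S : DartSystem D V} {p : D → D} {e f g k x y z : D} {w : V}

namespace Hex

theorem spoke_half_or (h : S.Hex p e f g) (hp : IsReversal S.Adj p) (hx : S.Spoke e f x) :
    S.Spoke (p e) (p f) (p x) ∨ S.Spoke g (p e) (S.r (p x)) :=
  h.spoke_or_half hp (.inl hx.1) hx.2 fun hxg => hx.1.asymm (hxg ▸ h.2.2.2.2.2)

section

variable (h : S.Hex p e f g) (hp : IsReversal S.Adj p) (hne : ∀ e, p e ≠ S.r e)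
include h hp hne

theorem spoke_half_r_or (hx : S.Spoke e f x) :
    S.Spoke (p f) (p g) (p (S.r x)) ∨ S.Spoke (p e) (p f) (S.r (p (S.r x))) := by
  have hxe := h.spoke_end hp hne hx
  simp only [List.mem_cons, List.not_mem_nil, or_false, not_or] at hxe
  refine (h.rot hp).spoke_or_half hp (.inr (hx.r_to h.1)) (fun hxg => ?_) fun hxe' => ?_
  · exact hxe.2.2.1 (by rw [← hxg, S.s_r])
  · rw [hp.apply_apply] at hxe'
    exact not_adj_r x (.inr (hxe' ▸ hx.1))

theorem spokes_half (hx : S.Spoke e f x) (hz : S.Spoke (p g) e z) :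
    S.Spoke (p e) (p f) (p x) ∧ S.Spoke g (p e) (S.r (p (S.r z))) := by
  have h' := h.of_spokes hp hne hx hz
  have ht := h.t_eq
  have ht' := h'.t_eq
  have hxe := h.spoke_end hp hne hx
  have hze := (h.rot_neg hp).spoke_end hp hne hz
  rw [spoke_iff (h.half hp).1, spoke_iff h.2.2.1]
  simp only [List.mem_cons, List.not_mem_nil, or_false, not_or, hp.apply_apply, S.s_r, S.t_r] at *
  grind

/-- Otherwise `x` is one of three alternating spokes, which `p` permutes up to reversal. -/
theorem spoke_half (hb : ∀ e, p (S.r (p (S.r (p e)))) ≠ S.r e) (hx : S.Spoke e f x) :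
    S.Spoke (p e) (p f) (p x) := by
  by_contra hpx
  have hy := (h.spoke_half_or hp hx).resolve_left hpx
  have hxe := h.spoke_end hp hne hx
  have no_spoke_half : ∀ z, ¬ S.Spoke (p e) (p f) z := fun z hz => by
    have := (((h.rot_rot hp).rot hp).spokes_half hp hne hz (by rwa [hp.apply_apply])).2
    rw [hp.apply_apply, r_r, hp.apply_apply] at this
    have hrx := ((spoke_iff h.2.2.2.2.2).1 this).1
    rw [S.s_r] at hrx
    exact hxe (by simp [hrx])
  have no_spoke_g : ∀ z, ¬ S.Spoke f g z := fun z hz =>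
    no_spoke_half _ ((h.rot hp).spokes_half hp hne hz (by rwa [hp.apply_apply])).2
  have hz := (h.spoke_half_r_or hp hne hx).resolve_right (no_spoke_half _)
  have hy' := (((h.half hp).rot hp).spoke_half_r_or hp hne hz).resolve_right fun hz' =>
    no_spoke_g _ (by simpa only [hp.apply_apply] using hz')
  simp only [hp.apply_apply] at hy'
  refine hb (p x) ?_
  rw [hp.apply_apply]
  exact (h.rot_rot hp).spoke_unique hp hne hy' hy

section

variable (hb : ∀ e, p (S.r (p (S.r (p e)))) ≠ S.r e)
include hb

theorem spoke_t_eq (hx : S.Spoke e f x) (hy : S.Spoke g (p e) y) : S.t x = S.t y := by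
  have hz : S.Spoke (p g) e (p y) := by
    simpa only [hp.apply_apply] using (h.rot_rot hp).spoke_half hp hne hb hy
  rw [(h.rot_rot hp).spoke_unique hp hne hy (h.spokes_half hp hne hx hz).2, S.t_r]
  exact (h.of_spokes hp hne hx hz).t_eq.2.1

theorem t_eq_of_side (hx : S.Spoke e f x) (hk : S.To x k) (hside : S.Adj k (p (S.r f))) :
    S.t k = S.s (p e) ∨ S.t k = S.s (p g) := by
  have hpx := h.spoke_half hp hne hb hx
  have hx' := (spoke_iff h.1).1 hx
  have hpx' := (spoke_iff h.2.2.2.1).1 hpx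
  have hxe := h.spoke_end hp hne hx
  have hn := h.nodup hp
  have ht := h.t_eq
  simp only [List.nodup_cons, List.mem_cons, List.not_mem_nil, or_false, not_or] at hn hxe
  rcases path_hex_or hp hne hk (hx.to_r h.1) hside with h' | ⟨-, -, hq | hq⟩
  · have ht' := h'.t_eq
    have hr : ¬ S.Spoke (p e) (p f) (S.r (p (S.r f))) := fun hr => by
      have := congrArg S.t ((h.half hp).spoke_unique hp hne hr hpx)
      have not_adj_k := hp.not_adj_self k
      simp only [Adj, To, S.s_r, S.t_r, hp.apply_apply] at *
      grind
    rw [spoke_iff h.2.2.2.1] at hr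
    simp only [To, S.s_r, S.t_r, hp.apply_apply] at *
    grind
  · have hs := hq.s_e
    refine absurd (hpx'.1.symm.trans hs).symm ?_
    exact h.spoke_t_ne hp hne ((spoke_iff h.1).2 ⟨hq.s_f.trans hx'.1, by grind⟩)
  · have hs := hq.t_e
    simp only [op, S.s_r] at hs
    grind

theorem spoke_r_or (hx : S.Spoke e f x) (hk : S.To x k) :
    S.Spoke g (p e) (S.r k) ∨ S.Spoke (p f) (p g) (S.r k) := by
  have hxe := h.spoke_end hp hne hx
  have hn := h.nodup hp
  have ht := h.t_eq
  have hrf := hx.to_r h.1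
  simp only [List.nodup_cons, List.mem_cons, List.not_mem_nil, or_false, not_or] at hn hxe
  rw [spoke_iff h.2.2.1, spoke_iff h.2.2.2.2.1, S.s_r, S.t_r, ← hk.1]
  suffices S.t k = S.s (p e) ∨ S.t k = S.s (p g) by grind
  have hef : e ≠ S.r f := fun h' => not_adj_r f (.inr (h' ▸ h.1))
  have hek : e ≠ k := fun h' => hk.asymm (h' ▸ hx.1)
  have hfk : S.r f ≠ k := fun h' => hk.asymm (h' ▸ hrf)
  rcases hp.side_pigeonhole x e (S.r f) k (.inr hx.1) (.inr hrf) (.inl hk) hef hfk hek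
    with hside | hside | hside
  · rw [← hp.adj_left_iff] at hside
    simp only [Adj, To, S.s_r, S.t_r] at *
    grind
  · exact h.t_eq_of_side hp hne hb hx hk (hp.adj_swap hside)
  · rw [← hp.adj_left_iff] at hside
    simp only [Adj, To] at *
    grind

theorem adj_spoke_end_iff (hx : S.Spoke e f x) : S.graph.Adj (S.t x) w ↔ w = S.s f ∨
    (∃ y, S.Spoke g (p e) y) ∧ w = S.s (p e) ∨ (∃ y, S.Spoke (p f) (p g) y) ∧ w = S.s (p g) := by
  have hxf := ((spoke_iff h.1).1 hx).1
  constructor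
  · rintro ⟨k, hk, rfl⟩
    by_cases hkf : S.t k = S.s f
    · exact .inl hkf
    right
    have hk' := h.spoke_r_or hp hne hb hx ⟨hk.symm, fun h => hkf (h.symm.trans hxf)⟩
    refine hk'.imp (fun hy => ⟨⟨_, hy⟩, ?_⟩) fun hy => ⟨⟨_, hy⟩, ?_⟩
    · rw [← hy.1.1.trans (S.s_r k), h.2.2.1.1]
    · rw [← hy.1.1.trans (S.s_r k), h.2.2.2.2.1.1]
  · rintro (rfl | ⟨⟨y, hy⟩, rfl⟩ | ⟨⟨y, hy⟩, rfl⟩)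
    · exact ⟨S.r x, S.s_r x, (S.t_r x).trans hxf⟩
    · refine ⟨S.r y, ?_, ?_⟩
      · rw [S.s_r, h.spoke_t_eq hp hne hb hx hy]
      · rw [S.t_r, ((spoke_iff h.2.2.1).1 hy).1]
    · refine ⟨S.r y, ?_, ?_⟩
      · rw [S.s_r, ((h.half hp).rot hp).spoke_t_eq hp hne hb hy (by simpa only [hp.apply_apply])]
      · rw [S.t_r, ((spoke_iff h.2.2.2.2.1).1 hy).1]

end

end

theorem adj_iff (h : S.Hex p e f g) {v : V} (hv : ∀ x, S.Spoke e f x → S.t x = v) :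
    S.graph.Adj (S.s f) w ↔ w = S.s e ∨ w = S.s g ∨ (∃ x, S.Spoke e f x) ∧ w = v := by
  have ht := h.t_eq
  constructor
  · rintro ⟨x, hx, rfl⟩
    by_cases hxe : S.t x = S.s e
    · exact .inl hxe
    by_cases hxg : S.t x = S.s g
    · exact .inr (.inl hxg)
    have hx' : S.Spoke e f x := (spoke_iff h.1).2 ⟨hx, hxe, by rwa [ht.2.1]⟩
    exact .inr (.inr ⟨⟨x, hx'⟩, hv x hx'⟩)
  · rintro (rfl | rfl | ⟨⟨x, hx⟩, rfl⟩)
    · exact ⟨S.r e, by rw [S.s_r, ht.1], S.t_r e⟩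
    · exact ⟨f, rfl, ht.2.1⟩
    · exact ⟨x, ((spoke_iff h.1).1 hx).1, hv x hx⟩

end Hex

end Hex

end DartSystem

/-- The hexagon `0, …, 5` with `7` joined to `1`, to `3` if `b` and to `5` if `c`, and `6` joined
to the opposite vertices. These are the graphs in which `Hex` can occur outside the braid case. -/
def cubicalGraph (b c : Bool) : SimpleGraph (Fin 8) where
  Adj i j := j ∈ (![[5, 1] ++ if b then [6] else [], [0, 2, 7], [1, 3] ++ if c then [6] else [],
    [2, 4] ++ if b then [7] else [], [3, 5, 6], [4, 0] ++ if c then [7] else [],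
    [4] ++ (if b then [0] else []) ++ if c then [2] else [],
    [1] ++ (if b then [3] else []) ++ if c then [5] else []] : Fin 8 → List (Fin 8)) i
  symm := ⟨by revert b c; decide⟩
  loopless := ⟨by revert b c; decide⟩

namespace cubicalGraph

instance (b c : Bool) : DecidableRel (cubicalGraph b c).Adj := fun _ _ =>
  inferInstanceAs (Decidable (_ ∈ _))

theorem card_dart (b c : Bool) :
    Nat.card (cubicalGraph b c).Dart = 16 + 4 * (b.toNat + c.toNat) := by
  rw [Nat.card_eq_fintype_card, SimpleGraph.dart_card_eq_sum_degrees]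
  revert b c
  decide

/-- The reflection of the hexagon that fixes `1` and `4`. -/
def swap (b c : Bool) : cubicalGraph b c ≃g cubicalGraph c b where
  toEquiv := Equiv.swap 0 2 * Equiv.swap 3 5
  map_rel_iff' := by revert b c; decide

theorem iso_of_card_dart_eq {b c b' c' : Bool}
    (h : Nat.card (cubicalGraph b c).Dart = Nat.card (cubicalGraph b' c').Dart) :
    Nonempty (cubicalGraph b c ≃g cubicalGraph b' c') := by
  rw [card_dart, card_dart] at h
  have : b = b' ∧ c = c' ∨ b = c' ∧ c = b' := by revert b c b' c'; decide
  rcases this with ⟨rfl, rfl⟩ | ⟨rfl, rfl⟩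
  · exact ⟨.refl⟩
  · exact ⟨swap b c⟩

end cubicalGraph

namespace DartSystem

section Chart

variable {D V : Type*} {S : DartSystem D V}

theorem graph_iso_of_chart {α : Type*} [Nonempty α] {G : SimpleGraph α} (hs : S.s.Surjective)
    (hS : S.Connected) {v : α → V} (hv : v.Injective)
    (h : ∀ i w, S.graph.Adj (v i) w ↔ ∃ j, G.Adj i j ∧ w = v j) : Nonempty (S.graph ≃g G) := by
  have s_mem_iff : ∀ e, S.s e ∈ Set.range v ↔ S.t e ∈ Set.range v := by
    have mem_of_adj : ∀ a b, S.graph.Adj a b → a ∈ Set.range v → b ∈ Set.range v := by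
      rintro _ b hab ⟨i, rfl⟩
      obtain ⟨j, -, rfl⟩ := (h i b).1 hab
      exact ⟨j, rfl⟩
    have s_adj_t : ∀ e, S.graph.Adj (S.s e) (S.t e) := fun e => ⟨e, rfl, rfl⟩
    exact fun e => ⟨mem_of_adj _ _ (s_adj_t e), mem_of_adj _ _ (s_adj_t e).symm⟩
  have surjective : v.Surjective := fun w => by
    obtain ⟨e, rfl⟩ := hs w
    obtain ⟨e₀, he₀⟩ := hs (v (Classical.arbitrary α))
    refine hS.induction (P := fun e => S.s e ∈ Set.range v) ⟨_, he₀.symm⟩ ?_ e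
    rintro e f ((hf | hf) | rfl) he
    · rwa [← hf.1, ← s_mem_iff]
    · rwa [s_mem_iff, hf.1]
    · rwa [S.s_r, ← s_mem_iff]
  refine ⟨.symm ⟨.ofBijective v ⟨hv, surjective⟩, fun {i j} => (h i (v j)).trans ?_⟩⟩
  simp only [hv.eq_iff, exists_eq_right']

theorem card_eq_card_dart {α : Type*} {G : SimpleGraph α} (φ : S.graph ≃g G) :
    Nat.card D = Nat.card G.Dart := by
  refine Nat.card_congr (.ofBijective
    (fun e => ⟨(φ (S.s e), φ (S.t e)), φ.map_adj_iff.2 ⟨e, rfl, rfl⟩⟩) ⟨fun e f h => ?_, ?_⟩)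
  · simp only [SimpleGraph.Dart.mk.injEq, Prod.mk.injEq, φ.injective.eq_iff] at h
    exact S.ext e f h.1 h.2
  · rintro ⟨⟨a, b⟩, hab⟩
    obtain ⟨e, hea, heb⟩ := φ.symm.map_adj_iff.2 hab
    exact ⟨e, by simp only [hea, heb, φ.apply_symm_apply]⟩

end Chart

section Hex

variable {D V W : Type*} {S : DartSystem D V} {T : DartSystem D W} {p : D → D} {e f g x : D}

theorem Hex.exists_spoke (h : S.Hex p e f g) (hp : IsReversal S.Adj p) (hC : Linked S.Adj) :
    ∃ e f g x, S.Hex p e f g ∧ S.Spoke e f x := by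
  by_contra! hn
  have adj_or {e f g y : D} (h : S.Hex p e f g) (hy : S.Adj e y) : y = f ∨ y = p g := by
    by_contra! hyf
    exact (h.spoke_or hy hyf.1 hyf.2).elim (hn _ _ _ _ h) (hn _ _ _ _ (h.rot_neg hp))
  have mem : S.r e ∈ [e, f, g, p e, p f, p g] := by
    refine hC.induction (P := (· ∈ [e, f, g, p e, p f, p g])) (e := e) (by simp) ?_ _
    intro a b hab ha
    simp only [List.mem_cons, List.not_mem_nil, or_false] at ha ⊢
    rcases ha with rfl | rfl | rfl | rfl | rfl | rfl
    · have := adj_or h hab; tauto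
    · have := adj_or (h.rot hp) hab; rw [hp.apply_apply] at this; tauto
    · have := adj_or (h.rot_rot hp) hab; rw [hp.apply_apply] at this; tauto
    · have := adj_or (h.half hp) hab; rw [hp.apply_apply] at this; tauto
    · have := adj_or ((h.half hp).rot hp) hab; simp only [hp.apply_apply] at this; tauto
    · have := adj_or (h.rot_neg hp) hab; tauto
  have hnd := h.nodup hp
  have ht := h.t_eq
  have s_r := S.s_r e
  have t_r := S.t_r e
  simp only [List.nodup_cons, List.mem_cons, List.not_mem_nil, or_false, not_or] at hnd mem
  grind

section

variable (h : S.Hex p e f g) (hp : IsReversal S.Adj p) (hne : ∀ e, p e ≠ S.r e)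
  (hb : ∀ e, p (S.r (p (S.r (p e)))) ≠ S.r e)
include h hp hne hb

theorem Hex.spoke_half_iff : (∃ y, S.Spoke (p e) (p f) y) ↔ ∃ y, S.Spoke e f y :=
  ⟨fun ⟨_, hy⟩ => ⟨_, by simpa only [hp.apply_apply] using (h.half hp).spoke_half hp hne hb hy⟩,
    fun ⟨_, hy⟩ => ⟨_, h.spoke_half hp hne hb hy⟩⟩

theorem Hex.t_ne_t_apply (hx : S.Spoke e f x) : S.t x ≠ S.t (p x) := by
  intro ht
  have hpx := h.spoke_half hp hne hb hx
  have adj_f := (h.adj_spoke_end_iff hp hne hb hx (w := S.s f)).2 (.inl rfl)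
  rw [ht, (h.half hp).adj_spoke_end_iff hp hne hb hpx] at adj_f
  have hn := h.nodup hp
  simp only [List.nodup_cons, List.mem_cons, List.not_mem_nil, or_false, not_or,
    hp.apply_apply] at hn adj_f
  grind

/-- A spoke forces spokes with the same end at every other vertex that has one. -/
theorem Hex.adj_alternate_iff (hx : S.Spoke e f x) (w : V) :
    (S.graph.Adj (S.s f) w ↔ w = S.s e ∨ w = S.s g ∨ w = S.t x) ∧
    (S.graph.Adj (S.s (p e)) w ↔
      w = S.s g ∨ w = S.s (p f) ∨ (∃ y, S.Spoke g (p e) y) ∧ w = S.t x) ∧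
    (S.graph.Adj (S.s (p g)) w ↔
      w = S.s (p f) ∨ w = S.s e ∨ (∃ y, S.Spoke (p f) (p g) y) ∧ w = S.t x) := by
  have h₃ := (h.rot_rot hp).adj_iff (w := w)
    fun y hy => (h.spoke_t_eq hp hne hb hx hy).symm
  have h₅ := ((h.half hp).rot hp).adj_iff (w := w)
    fun y hy => ((h.half hp).rot hp).spoke_t_eq hp hne hb hy (by simpa only [hp.apply_apply])
  rw [hp.apply_apply] at h₅
  refine ⟨?_, h₃, h₅⟩
  rw [h.adj_iff fun y hy => congrArg S.t (h.spoke_unique hp hne hy hx)]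
  simp only [show ∃ y, S.Spoke e f y from ⟨x, hx⟩, true_and]

theorem Hex.graph_iso_cubicalGraph_of_spoke (hs : S.s.Surjective) (hS : S.Connected)
    (hx : S.Spoke e f x) : ∃ b c, Nonempty (S.graph ≃g cubicalGraph b c) := by
  classical
  have hpx := h.spoke_half hp hne hb hx
  obtain ⟨b, spoke_g_iff⟩ : ∃ b : Bool, (∃ y, S.Spoke g (p e) y) ↔ b := ⟨_, decide_eq_true_iff.symm⟩
  obtain ⟨c, spoke_f_iff⟩ : ∃ c : Bool, (∃ y, S.Spoke f g y) ↔ c := ⟨_, decide_eq_true_iff.symm⟩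
  refine ⟨b, c, graph_iso_of_chart hs hS (v := ![S.s e, S.s f, S.s g, S.s (p e), S.s (p f),
    S.s (p g), S.t (p x), S.t x]) ?_ fun i w => ?_⟩
  · have hxe := h.spoke_end hp hne hx
    have hpxe := (h.half hp).spoke_end hp hne hpx
    have hxp := h.t_ne_t_apply hp hne hb hx
    have hn := h.nodup hp
    rw [← List.nodup_ofFn]
    simp only [List.ofFn_succ, List.ofFn_zero, Matrix.cons_val_zero, Matrix.cons_val_succ,
      List.nodup_cons, List.mem_cons, List.not_mem_nil, or_false, not_or, hp.apply_apply] at *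
    grind
  · have spoke_f_iff' := ((h.rot hp).spoke_half_iff hp hne hb).trans spoke_f_iff
    have spoke_g_iff' := ((h.rot_rot hp).spoke_half_iff hp hne hb).trans spoke_g_iff
    have odd := h.adj_alternate_iff hp hne hb hx w
    have even := (h.half hp).adj_alternate_iff hp hne hb hpx w
    have adj_t := h.adj_spoke_end_iff hp hne hb hx (w := w)
    have adj_t' := (h.half hp).adj_spoke_end_iff hp hne hb hpx (w := w)
    simp only [hp.apply_apply] at spoke_g_iff'
    simp only [hp.apply_apply, spoke_f_iff, spoke_f_iff', spoke_g_iff, spoke_g_iff']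
      at odd even adj_t adj_t'
    fin_cases i <;>
      simp [cubicalGraph, odd, even, adj_t, adj_t', or_and_right, exists_or, and_assoc]

end

theorem Hex.graph_iso_cubicalGraph (h : S.Hex p e f g) (hp : IsReversal S.Adj p)
    (hne : ∀ e, p e ≠ S.r e) (hb : ∀ e, p (S.r (p (S.r (p e)))) ≠ S.r e) (hs : S.s.Surjective)
    (hC : Linked S.Adj) : ∃ b c, Nonempty (S.graph ≃g cubicalGraph b c) :=
  let ⟨_, _, _, _, h, hx⟩ := h.exists_spoke hp hC
  h.graph_iso_cubicalGraph_of_spoke hp hne hb hs (.of_linked hC) hx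

theorem exists_hex_of_hex (hA : ∀ e f, S.Adj e f ↔ T.Adj e f) (hne : ∀ e, T.r e ≠ S.r e)
    (hC : Linked S.Adj) (h : S.Hex T.r e f g) : ∃ e f g, T.Hex S.r e f g := by
  have hp := isReversal_of_adj_iff hA
  by_contra! hn
  obtain ⟨e, f, g, x, h, hx⟩ := h.exists_spoke hp hC
  have third := adj_apply_r_or hA (fun e => (hne e).symm) hn (.inl h.1) (.inl hx.1) hx.2.symm
    (h.not_side hp hne hx) (iff_of_true h.1 hx.1)
  have hnd := h.nodup hp
  have ht := h.t_eq
  have hxe := h.spoke_end hp hne hx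
  obtain ⟨hx, -⟩ := hx
  simp only [List.nodup_cons, List.mem_cons, List.not_mem_nil, or_false, not_or] at hnd hxe
  rw [← hp.adj_left_iff, ← hp.adj_left_iff] at third
  simp only [Adj, To, S.s_r, S.t_r] at third
  simp only [To] at hx
  grind

/-- Outside the braid case both graphs are some `cubicalGraph`, and the number of darts tells the
isomorphism types of these apart. -/
theorem graph_iso_of_hex (hs : S.s.Surjective) (ht : T.s.Surjective)
    (hA : ∀ e f, S.Adj e f ↔ T.Adj e f) (hC : Linked S.Adj) (hne : ∀ e, T.r e ≠ S.r e)
    (h : S.Hex T.r e f g) : Nonempty (S.graph ≃g T.graph) := by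
  have hA' : ∀ e f, T.Adj e f ↔ S.Adj e f := fun e f => (hA e f).symm
  by_cases hb : ∀ e, T.r (S.r (T.r (S.r (T.r e)))) ≠ S.r e
  · have hb' : ∀ e, S.r (T.r (S.r (T.r (S.r e)))) ≠ T.r e := fun e he =>
      hb (T.r (S.r e)) (by rw [T.r_r, r_r, ← T.r_eq_iff.1 (S.r_eq_iff.1 he)])
    obtain ⟨_, _, _, h'⟩ := exists_hex_of_hex hA hne hC h
    obtain ⟨b, c, ⟨φ⟩⟩ := h.graph_iso_cubicalGraph (isReversal_of_adj_iff hA) hne hb hs hC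
    obtain ⟨b', c', ⟨ψ⟩⟩ := h'.graph_iso_cubicalGraph (isReversal_of_adj_iff hA')
      (fun e => (hne e).symm) hb' ht (hC.mono fun _ _ h => (hA _ _).1 h)
    obtain ⟨χ⟩ := cubicalGraph.iso_of_card_dart_eq
      ((card_eq_card_dart φ).symm.trans (card_eq_card_dart ψ))
    exact ⟨(φ.trans χ).trans ψ.symm⟩
  · push Not at hb
    obtain ⟨e, he⟩ := hb
    exact graph_iso_of_braid hs ht hA hC he

end Hex

section Main

variable {D V W : Type*} {S : DartSystem D V} {T : DartSystem D W}

theorem graph_iso_of_adj_iff [Nonempty D] (hs : S.s.Surjective) (ht : T.s.Surjective)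
    (hS : S.Connected) (hT : T.Connected) (hA : ∀ e f, S.Adj e f ↔ T.Adj e f) :
    Nonempty (S.graph ≃g T.graph) := by
  by_cases hC : Linked S.Adj
  swap
  · exact graph_iso_of_not_linked hs ht hS hT hA hC
  by_cases! hne : ∃ e, T.r e = S.r e
  · exact graph_iso_of_common_reversal hs ht hA hC hne.choose_spec
  by_cases! hn : ∃ e f g, S.Hex T.r e f g
  · obtain ⟨e, f, g, h⟩ := hn
    exact graph_iso_of_hex hs ht hA hC hne h
  by_cases! hn' : ∃ e f g, T.Hex S.r e f g
  · obtain ⟨e, f, g, h⟩ := hn'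
    exact (graph_iso_of_hex ht hs (fun e f => (hA e f).symm)
      (hC.mono fun _ _ => (hA _ _).1) (fun e => (hne e).symm) h).map (·.symm)
  exact graph_iso_of_no_hex hs ht hA hC hne hn hn'

theorem Connected.comap {D' : Type*} (hS : S.Connected) (θ : D' ≃ D) :
    (S.comap θ).Connected := fun e f => by
  have := (hS (θ e) (θ f)).lift θ.symm
    (p := fun e f => (S.comap θ).Adj e f ∨ f = (S.comap θ).r e) fun a b hab => by
      change S.Adj (θ (θ.symm a)) (θ (θ.symm b)) ∨ θ.symm b = θ.symm (S.r (θ (θ.symm a)))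
      rwa [θ.apply_symm_apply, θ.apply_symm_apply, θ.symm.injective.eq_iff]
  rwa [Function.onFun, θ.symm_apply_apply, θ.symm_apply_apply] at this

end Main

section OfGraph

variable {V : Type*}

/-- The dart system of the oriented edges of a graph. -/
def ofGraph (X : SimpleGraph V) : DartSystem X.Dart V where
  s e := e.fst
  t e := e.snd
  r e := e.symm
  s_r _ := rfl
  t_r _ := rfl
  s_ne_t e := e.adj.ne
  ext _ _ h h' := SimpleGraph.Dart.ext _ _ (Prod.ext h h')

theorem ofGraph_graph (X : SimpleGraph V) : (ofGraph X).graph = X := by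
  ext a b
  exact ⟨fun ⟨e, h, h'⟩ => h ▸ h' ▸ e.adj, fun h => ⟨⟨(a, b), h⟩, rfl, rfl⟩⟩

theorem ofGraph_adj [DecidableEq V] (X : SimpleGraph V) (e f : X.Dart) :
    (ofGraph X).Adj e f ↔ X.symmEdgeGraph.Adj e f := (X.symmEdgeGraph_adj e f).symm

theorem ofGraph_s_surjective {X : SimpleGraph V} (hX : X.Connected) [Nonempty X.Dart] :
    (ofGraph X).s.Surjective := fun v => by
  have d : X.Dart := Classical.arbitrary _
  obtain ⟨w⟩ := hX.preconnected v d.fst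
  cases w with
  | nil => exact ⟨d, rfl⟩
  | cons h _ => exact ⟨⟨(v, _), h⟩, rfl⟩

theorem ofGraph_connected {X : SimpleGraph V} (hX : X.Connected) : (ofGraph X).Connected := by
  intro e f
  set R := fun e f => (ofGraph X).Adj e f ∨ f = (ofGraph X).r e
  have of_s_eq {e f : X.Dart} (h : e.fst = f.fst) : Relation.ReflTransGen R e f := by
    rcases (ofGraph X).s_eq_iff.1 h with rfl | h
    · exact .refl
    · exact .trans (.single (.inr rfl)) (.single (.inl (.inl h)))
  obtain ⟨w⟩ := hX.preconnected e.fst f.fst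
  generalize ha : e.fst = a, hb : f.fst = b at w
  induction w generalizing e with
  | nil => exact of_s_eq (ha.trans hb.symm)
  | cons h _ ih =>
    let d : X.Dart := ⟨(_, _), h⟩
    exact (of_s_eq (f := d) ha).trans (.head (.inr rfl) (ih d.symm rfl hb))

end OfGraph

end DartSystem

theorem nonempty_symmEdgeGraph_iso {V W : Type*} [DecidableEq V] [DecidableEq W]
    {X : SimpleGraph V} {Y : SimpleGraph W} (φ : X ≃g Y) :
    Nonempty (X.symmEdgeGraph ≃g Y.symmEdgeGraph) := by
  refine ⟨⟨⟨φ.toHom.mapDart, φ.symm.toHom.mapDart, fun e => ?_, fun e => ?_⟩, fun {e f} => ?_⟩⟩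
  · exact SimpleGraph.Dart.ext _ _
      (Prod.ext (φ.symm_apply_apply _) (φ.symm_apply_apply _))
  · exact SimpleGraph.Dart.ext _ _
      (Prod.ext (φ.apply_symm_apply _) (φ.apply_symm_apply _))
  · simp [SimpleGraph.symmEdgeGraph_adj, φ.injective.eq_iff]

theorem eq_bot_of_isEmpty_dart {V : Type*} (X : SimpleGraph V) [IsEmpty X.Dart] : X = ⊥ :=
  SimpleGraph.eq_bot_iff_forall_not_adj.2 fun a b h => IsEmpty.false (⟨(a, b), h⟩ : X.Dart)

theorem nonempty_iso_of_isEmpty_dart {V W : Type*} {X : SimpleGraph V} {Y : SimpleGraph W}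
    [IsEmpty X.Dart] [IsEmpty Y.Dart] (hX : X.Connected) (hY : Y.Connected) :
    Nonempty (X ≃g Y) := by
  rw [eq_bot_of_isEmpty_dart X, SimpleGraph.connected_bot_iff] at hX
  rw [eq_bot_of_isEmpty_dart Y, SimpleGraph.connected_bot_iff] at hY
  obtain ⟨_, ⟨v⟩⟩ := hX
  obtain ⟨_, ⟨w⟩⟩ := hY
  rw [eq_bot_of_isEmpty_dart X, eq_bot_of_isEmpty_dart Y]
  exact ⟨⟨⟨fun _ => w, fun _ => v, fun _ => Subsingleton.elim _ _, fun _ => Subsingleton.elim _ _⟩,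
    Iff.rfl⟩⟩

theorem nonempty_iso_of_symmEdgeGraph_iso {V W : Type*} [DecidableEq V] [DecidableEq W]
    {X : SimpleGraph V} {Y : SimpleGraph W} (hX : X.Connected) (hY : Y.Connected)
    (φ : X.symmEdgeGraph ≃g Y.symmEdgeGraph) : Nonempty (X ≃g Y) := by
  cases isEmpty_or_nonempty X.Dart
  · have := φ.symm.toEquiv.isEmpty
    exact nonempty_iso_of_isEmpty_dart hX hY
  · have := φ.symm.toEquiv.nonempty
    have key := DartSystem.graph_iso_of_adj_iff (DartSystem.ofGraph_s_surjective hX)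
      (T := (DartSystem.ofGraph Y).comap φ.toEquiv)
      ((DartSystem.ofGraph_s_surjective hY).comp φ.surjective)
      (DartSystem.ofGraph_connected hX) ((DartSystem.ofGraph_connected hY).comap _)
      fun e f => by
        rw [DartSystem.comap_adj, DartSystem.ofGraph_adj, DartSystem.ofGraph_adj]
        exact φ.map_adj_iff.symm
    rwa [DartSystem.comap_graph, DartSystem.ofGraph_graph, DartSystem.ofGraph_graph] at key

theorem mainTheorem2_general {V : Type*} {W : Type*} [DecidableEq V] [DecidableEq W]
    (X : SimpleGraph V) (Y : SimpleGraph W) (hX : X.Connected) (hY : Y.Connected) :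
    Nonempty (X.symmEdgeGraph ≃g Y.symmEdgeGraph) ↔ Nonempty (X ≃g Y) :=
  ⟨fun ⟨φ⟩ => nonempty_iso_of_symmEdgeGraph_iso hX hY φ, fun ⟨φ⟩ => nonempty_symmEdgeGraph_iso φ⟩

theorem mainTheorem2 {V : Type*} {W : Type*} [Fintype V] [DecidableEq V]
    [Fintype W] [DecidableEq W] (X : SimpleGraph V) (Y : SimpleGraph W)
    (hX : X.Connected) (hY : Y.Connected) :
    Nonempty (X.symmEdgeGraph ≃g Y.symmEdgeGraph) ↔ Nonempty (X ≃g Y) :=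
  mainTheorem2_general X Y hX hY
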